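/- Let $W=W(E_{10})$ be the Coxeter group with generators $s_0,\dots,s_9$, where $s_1,\dots,s_9$ form a chain in this order and $s_0$ is joined only to $s_3$. Let $W$ act on $\mathbb R^{1,10}$ with orthogonal basis $\mathbf e_0,\dots,\mathbf e_{10}$, $\mathbf e_0^2=1$, $\mathbf e_i^2=-1$ $(i\ge 1)$, where $s_i$ acts as the reflection in $\alpha_0=\mathbf e_0-\mathbf e_1-\mathbf e_2-\mathbf e_3$ for $i=0$ and in $\alpha_i=\mathbf e_i-\mathbf e_{i+1}$ for $i\ge1$. Let $\rho(\omega)$ be the spectral radius of $\omega$ in this representation, and let $W(A_9)=\langle s_1,\dots,s_9\rangle$. For a 3-element set $I=\{i,j,k\}\subset\{1,\dots,10\}$ let $\kappa_I\in W$ be the reflection in $\mathbf e_0-\mathbf e_i-\mathbf e_j-\mathbf e_k$, that is, $\kappa_I=\sigma s_0\sigma^{-1}$ for any $\sigma\in W(A_9)$ that takes $\{1,2,3\}$ to $I$. The $s_0$-length of $\omega\in W$ is the least number of occurrences of $s_0$ in a reduced expression of $\omega$, and its $s_0$-level is the least $s_0$-length of a conjugate of $\omega$. For $n\ge 1$ put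 $$\mathcal D_n=\bigcup W(A_9)\,\kappa_{I_1}\cdots\kappa_{I_n}\,W(A_9),$$ the union over all $n$-tuples $(I_1,\dots,I_n)$ for which $\kappa_{I_1}\cdots\kappa_{I_n}$ has $s_0$-length $n$, and let $\mathcal D_{n,n}$ be the set of elements of $\mathcal D_n$ of $s_0$-level $n$. Define $$\tilde\Lambda_n=\{\rho(\omega):\omega\in\mathcal D_n\},\qquad \Lambda_n=\{\rho(\omega):\omega\in\mathcal D_{n,n}\},\qquad M_n=\max\tilde\Lambda_n .$$ **Lemma.** For every $k\ge1$ the maximum $M_k$ of $\tilde\Lambda_k$ exists, it is also the maximum of $\Lambda_k$, and $$M_k=M_1^{\,k}.$$ Moreover $M_1$ is the largest real root of $t^{10}-t^9-t^8+t^7-t^5+t^3-t^2-t+1$, and $M_1\approx 1.43100$, that is, $|M_1-1.43100|\le 5\cdot 10^{-6}$. -/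

import Mathlib

open Matrix

noncomputable section

namespace E10

/-! ### The Coxeter group `W(E₁₀)` and its Lorentzian representation -/

/-- Adjacency in the `E₁₀` Dynkin diagram: the nodes `1, …, 9` form a chain, in this order, and
the node `0` is joined to the node `3` only. -/
def Adj (i j : Fin 10) : Prop :=
  (1 ≤ i.val ∧ i.val + 1 = j.val) ∨ (1 ≤ j.val ∧ j.val + 1 = i.val) ∨
    (i.val = 0 ∧ j.val = 3) ∨ (i.val = 3 ∧ j.val = 0)

instance (i j : Fin 10) : Decidable (Adj i j) := by unfold Adj; infer_instance

/-- The Coxeter matrix of type `E₁₀`. -/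
def coxeterMatrix : CoxeterMatrix (Fin 10) where
  M := Matrix.of fun i j => if i = j then 1 else if Adj i j then 3 else 2
  isSymm := by
    ext i j
    simp only [Matrix.transpose_apply, Matrix.of_apply]
    revert i j
    decide
  diagonal := by simp
  off_diagonal := by
    intro i j hij
    simp only [Matrix.of_apply, if_neg hij]
    split_ifs <;> norm_num

/-- The Coxeter group `W(E₁₀)`. -/
abbrev W : Type := coxeterMatrix.Group

/-- The Coxeter system `(W(E₁₀), {s₀, …, s₉})`. -/
abbrev cs : CoxeterSystem coxeterMatrix W := coxeterMatrix.toCoxeterSystem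

/-- The orthonormal basis `e₀, …, e₁₀` of `ℝ^{1,10}`. -/
def e (i : Fin 11) : Fin 11 → ℝ := Pi.single i 1

/-- The Gram matrix `diag(1, -1, …, -1)` of the Lorentzian form on `ℝ^{1,10}`. -/
def gram : Matrix (Fin 11) (Fin 11) ℝ := Matrix.diagonal fun i => if i = 0 then 1 else -1

/-- The Lorentzian form `x · y`. -/
def lorentz (x y : Fin 11 → ℝ) : ℝ := x ⬝ᵥ (gram *ᵥ y)

/-- The simple roots `α₀ = e₀ - e₁ - e₂ - e₃` and `αᵢ = eᵢ - eᵢ₊₁` for `1 ≤ i ≤ 9`. -/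
def simpleRoot (i : Fin 10) : Fin 11 → ℝ :=
  if i = 0 then e 0 - e 1 - e 2 - e 3 else e i.castSucc - e i.succ

/-- The matrix, in the basis `e₀, …, e₁₀`, of the map `v ↦ v + (v · α) α`, which is the reflection
in `α` if `α · α = -2`. -/
def reflMatrix (α : Fin 11 → ℝ) : Matrix (Fin 11) (Fin 11) ℝ :=
  1 + Matrix.vecMulVec α (gram *ᵥ α)

theorem reflMatrix_mulVec (α v : Fin 11 → ℝ) :
    reflMatrix α *ᵥ v = v + lorentz v α • α := by
  unfold reflMatrix lorentz
  rw [Matrix.add_mulVec, Matrix.one_mulVec, Matrix.vecMulVec_mulVec, dotProduct_comm]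
  ext i
  simp [mul_comm]

theorem lorentz_e (i j : Fin 11) :
    lorentz (e i) (e j) = if i = j then (if i = 0 then 1 else -1) else 0 := by
  simp only [lorentz, gram, e, single_one_dotProduct, Matrix.mulVec_diagonal, Pi.single_apply,
    mul_ite, mul_one, mul_zero]

theorem lorentz_sub_left (x y z : Fin 11 → ℝ) :
    lorentz (x - y) z = lorentz x z - lorentz y z := by
  simp [lorentz, sub_dotProduct]

theorem lorentz_sub_right (x y z : Fin 11 → ℝ) :
    lorentz x (y - z) = lorentz x y - lorentz x z := by
  simp [lorentz, Matrix.mulVec_sub, dotProduct_sub]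

theorem lorentz_simpleRoot (i j : Fin 10) : lorentz (simpleRoot i) (simpleRoot j) =
    if i = j then -2 else if Adj i j then 1 else 0 := by
  fin_cases i <;> fin_cases j <;>
    simp only [simpleRoot, lorentz_sub_left, lorentz_sub_right, lorentz_e, Fin.reduceFinMk,
      Fin.reduceEq, Fin.reduceCastSucc, Fin.reduceSucc, Fin.zero_eta, Fin.isValue, Fin.mk_one,
      if_true, if_false, Adj] <;> norm_num

theorem lorentz_comm (x y : Fin 11 → ℝ) : lorentz x y = lorentz y x := by
  simp only [lorentz, gram, dotProduct, Matrix.mulVec_diagonal]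
  exact Finset.sum_congr rfl fun i _ => by ring

theorem vecMulVec_gram_mul (α β : Fin 11 → ℝ) :
    Matrix.vecMulVec α (gram *ᵥ α) * Matrix.vecMulVec β (gram *ᵥ β) =
      lorentz α β • Matrix.vecMulVec α (gram *ᵥ β) := by
  rw [Matrix.vecMulVec_mul_vecMulVec, Matrix.vecMulVec_smul]
  congr 1
  simp only [lorentz, gram, dotProduct, Matrix.mulVec_diagonal]
  exact Finset.sum_congr rfl fun i _ => by ring

theorem vecMulVec_gram_mul_mul (α β : Fin 11 → ℝ) :
    Matrix.vecMulVec α (gram *ᵥ α) * Matrix.vecMulVec β (gram *ᵥ β) *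
        Matrix.vecMulVec α (gram *ᵥ α) =
      (lorentz α β * lorentz α β) • Matrix.vecMulVec α (gram *ᵥ α) := by
  rw [vecMulVec_gram_mul, Matrix.smul_mul, Matrix.vecMulVec_mul_vecMulVec,
    Matrix.vecMulVec_smul, smul_smul]
  congr 2
  rw [lorentz_comm]
  simp only [lorentz, gram, dotProduct, Matrix.mulVec_diagonal]
  exact Finset.sum_congr rfl fun i _ => by ring

theorem reflMatrix_mul_self {α : Fin 11 → ℝ} (h : lorentz α α = -2) :
    reflMatrix α * reflMatrix α = 1 := by
  have hP := vecMulVec_gram_mul α α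
  rw [h] at hP
  unfold reflMatrix
  generalize Matrix.vecMulVec α (gram *ᵥ α) = P at hP
  rw [add_mul, mul_add, mul_add, hP, one_mul, one_mul, mul_one]
  module

/-- The reflections in the simple roots satisfy the Coxeter relations of `W(E₁₀)`. -/
theorem isLiftable_reflMatrix :
    coxeterMatrix.IsLiftable fun i => reflMatrix (simpleRoot i) := by
  intro i j
  have hself : ∀ k, reflMatrix (simpleRoot k) * reflMatrix (simpleRoot k) = 1 := fun k =>
    reflMatrix_mul_self (by simp [lorentz_simpleRoot])
  have hM : coxeterMatrix i j = if i = j then 1 else if Adj i j then 3 else 2 := rfl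
  rw [hM]
  have hij := lorentz_simpleRoot i j
  have hji := lorentz_comm (simpleRoot j) (simpleRoot i)
  have hPQ := vecMulVec_gram_mul (simpleRoot i) (simpleRoot j)
  have hQP := vecMulVec_gram_mul (simpleRoot j) (simpleRoot i)
  have hPQP := vecMulVec_gram_mul_mul (simpleRoot i) (simpleRoot j)
  have hQPQ := vecMulVec_gram_mul_mul (simpleRoot j) (simpleRoot i)
  have hPP := vecMulVec_gram_mul (simpleRoot i) (simpleRoot i)
  have hQQ := vecMulVec_gram_mul (simpleRoot j) (simpleRoot j)
  rw [show lorentz (simpleRoot i) (simpleRoot i) = -2 by simp [lorentz_simpleRoot]] at hPP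
  rw [show lorentz (simpleRoot j) (simpleRoot j) = -2 by simp [lorentz_simpleRoot]] at hQQ
  have hi := hself i
  have hj := hself j
  by_cases h : i = j
  · subst h
    simpa using hself i
  by_cases ha : Adj i j
  · simp only [h, ha, if_false, if_true] at hij ⊢
    rw [hji, hij] at hQPQ
    rw [hij] at hPQP
    have hbraid : reflMatrix (simpleRoot i) * reflMatrix (simpleRoot j) *
        reflMatrix (simpleRoot i) = reflMatrix (simpleRoot j) * reflMatrix (simpleRoot i) *
        reflMatrix (simpleRoot j) := by
      unfold reflMatrix
      generalize Matrix.vecMulVec (simpleRoot i) (gram *ᵥ simpleRoot i) = P at *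
      generalize Matrix.vecMulVec (simpleRoot j) (gram *ᵥ simpleRoot j) = Q at *
      simp only [add_mul, mul_add, one_mul, mul_one, hPQP, hQPQ, hPP, hQQ]
      module
    calc (reflMatrix (simpleRoot i) * reflMatrix (simpleRoot j)) ^ 3
        = (reflMatrix (simpleRoot i) * reflMatrix (simpleRoot j) * reflMatrix (simpleRoot i)) *
          (reflMatrix (simpleRoot j) * reflMatrix (simpleRoot i) *
            reflMatrix (simpleRoot j)) := by noncomm_ring
      _ = (reflMatrix (simpleRoot i) * reflMatrix (simpleRoot j) * reflMatrix (simpleRoot i)) *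
          (reflMatrix (simpleRoot i) * reflMatrix (simpleRoot j) *
            reflMatrix (simpleRoot i)) := by rw [hbraid]
      _ = reflMatrix (simpleRoot i) * (reflMatrix (simpleRoot j) *
          (reflMatrix (simpleRoot i) * reflMatrix (simpleRoot i)) *
            reflMatrix (simpleRoot j)) * reflMatrix (simpleRoot i) := by simp only [mul_assoc]
      _ = 1 := by rw [hi, mul_one, hj, mul_one, hi]
  · simp only [h, ha, if_false] at hij ⊢
    rw [hji, hij, zero_smul] at hQP
    rw [hij, zero_smul] at hPQ
    have hcomm : reflMatrix (simpleRoot j) * reflMatrix (simpleRoot i) =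
        reflMatrix (simpleRoot i) * reflMatrix (simpleRoot j) := by
      unfold reflMatrix
      simp only [add_mul, mul_add, one_mul, mul_one, hPQ, hQP]
      abel
    calc (reflMatrix (simpleRoot i) * reflMatrix (simpleRoot j)) ^ 2
        = reflMatrix (simpleRoot i) * (reflMatrix (simpleRoot j) * reflMatrix (simpleRoot i)) *
            reflMatrix (simpleRoot j) := by rw [pow_two]; simp only [mul_assoc]
      _ = (reflMatrix (simpleRoot i) * reflMatrix (simpleRoot i)) *
          (reflMatrix (simpleRoot j) * reflMatrix (simpleRoot j)) := by
            rw [hcomm]; simp only [mul_assoc]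
      _ = 1 := by rw [hi, hj, mul_one]

/-- The representation of `W(E₁₀)` on `ℝ^{1,10}` in which `sᵢ` acts as the reflection in `αᵢ`;
`rep ω` is the matrix of `ω` in the basis `e₀, …, e₁₀`. -/
def rep : W →* Matrix (Fin 11) (Fin 11) ℝ :=
  cs.lift ⟨fun i => reflMatrix (simpleRoot i), isLiftable_reflMatrix⟩

theorem rep_simple (i : Fin 10) : rep (cs.simple i) = reflMatrix (simpleRoot i) :=
  cs.lift_apply_simple isLiftable_reflMatrix i

/-- The spectral radius `ρ(ω)`: the largest modulus of a complex eigenvalue of the matrix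
of `ω`. -/
def rho (ω : W) : ℝ := (spectralRadius ℂ ((rep ω).map (algebraMap ℝ ℂ))).toReal

/-! ### The parabolic subgroup `W(A₉)` and the reflections `κ_I` -/

/-- The parabolic subgroup `W(A₉) = ⟨s₁, …, s₉⟩`. -/
def WA9 : Subgroup W := Subgroup.closure {w | ∃ i : Fin 10, i ≠ 0 ∧ w = cs.simple i}

/-- The set `T` of 3-element subsets of `{1, …, 10}`; here `a : Fin 10` stands for the
index `a + 1`, that is, for the basis vector `e a.succ`. -/
abbrev Triple : Type := {I : Finset (Fin 10) // I.card = 3}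

/-- The root `e₀ - eᵢ - eⱼ - eₖ` of a triple `{i, j, k}`. -/
def tripleRoot (I : Triple) : Fin 11 → ℝ := e 0 - ∑ a ∈ I.1, e a.succ

theorem reflMatrix_simple_e (i : Fin 9) (a : Fin 10) :
    reflMatrix (simpleRoot i.succ) *ᵥ e a.succ =
      e (Equiv.swap i.castSucc i.succ a).succ := by
  rw [reflMatrix_mulVec]
  have h0 : simpleRoot i.succ = e i.castSucc.succ - e i.succ.succ := by
    simp [simpleRoot, Fin.succ_ne_zero]
  have h1 : ∀ b c : Fin 10, lorentz (e b.succ) (e c.succ) = if b = c then -1 else 0 := by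
    intro b c
    simp only [lorentz_e, Fin.succ_inj, Fin.succ_ne_zero, if_false]
  have hne : i.castSucc ≠ i.succ := (Fin.castSucc_lt_succ (i := i)).ne
  rw [h0, lorentz_sub_right, h1, h1]
  rcases eq_or_ne a i.castSucc with rfl | ha
  · simp [hne]
  rcases eq_or_ne a i.succ with rfl | hb
  · simp [hne.symm]
  · rw [Equiv.swap_apply_of_ne_of_ne ha hb]
    simp [ha, hb]

/-- Every permutation of `e₁, …, e₁₀` is induced by an element of `W(A₉)`. -/
theorem exists_mem_WA9_perm (π : Equiv.Perm (Fin 10)) :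
    ∃ σ ∈ WA9, ∀ a : Fin 10, rep σ *ᵥ e a.succ = e (π a).succ := by
  have hπ : π ∈ Submonoid.closure
      (Set.range fun i : Fin 9 => Equiv.swap i.castSucc i.succ) := by
    rw [Equiv.Perm.mclosure_swap_castSucc_succ]
    trivial
  induction hπ using Submonoid.closure_induction with
  | mem x hx =>
    obtain ⟨i, rfl⟩ := hx
    exact ⟨cs.simple i.succ, Subgroup.subset_closure ⟨_, Fin.succ_ne_zero i, rfl⟩, fun a => by
      rw [rep_simple, reflMatrix_simple_e]⟩
  | one => exact ⟨1, one_mem _, fun a => by simp⟩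
  | mul x y _ _ hx hy =>
    obtain ⟨σ, hσ, h1⟩ := hx
    obtain ⟨τ, hτ, h2⟩ := hy
    exact ⟨σ * τ, mul_mem hσ hτ, fun a => by
      rw [map_mul, ← Matrix.mulVec_mulVec, h2, h1, Equiv.Perm.mul_apply]⟩

/-- For every triple `I` some `σ ∈ W(A₉)` permutes `e₁, …, e₁₀` and takes `{1, 2, 3}` to `I`. -/
theorem exists_sigma (I : Triple) : ∃ σ ∈ WA9, ∃ π : Equiv.Perm (Fin 10),
    (∀ a : Fin 10, rep σ *ᵥ e a.succ = e (π a).succ) ∧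
      ({0, 1, 2} : Finset (Fin 10)).map π.toEmbedding = I.1 := by
  have hc : Fintype.card {x // x ∈ ({0, 1, 2} : Finset (Fin 10))} =
      Fintype.card {x // x ∈ I.1} := by
    rw [Fintype.card_coe, Fintype.card_coe, I.2]
    rfl
  let f := Fintype.equivOfCardEq hc
  let π : Equiv.Perm (Fin 10) := f.extendSubtype
  obtain ⟨σ, hσ, h⟩ := exists_mem_WA9_perm π
  refine ⟨σ, hσ, π, h, ?_⟩
  apply Finset.eq_of_subset_of_card_le
  · intro b hb
    obtain ⟨a, ha, rfl⟩ := Finset.mem_map.1 hb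
    exact f.extendSubtype_mem a ha
  · rw [Finset.card_map, I.2]
    rfl

/-- The reflection `κ_I = σ s₀ σ⁻¹`, where `σ ∈ W(A₉)` is any element that takes `{1, 2, 3}`
to `I`. -/
def kappa (I : Triple) : W :=
  (exists_sigma I).choose * cs.simple 0 * ((exists_sigma I).choose)⁻¹

theorem lorentz_reflMatrix {α : Fin 11 → ℝ} (h : lorentz α α = -2) (x y : Fin 11 → ℝ) :
    lorentz (reflMatrix α *ᵥ x) (reflMatrix α *ᵥ y) = lorentz x y := by
  have hadd : ∀ a b c d : Fin 11 → ℝ, ∀ r s : ℝ, lorentz (a + r • b) (c + s • d) =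
      lorentz a c + s * lorentz a d + r * lorentz b c + r * s * lorentz b d := by
    intro a b c d r s
    simp only [lorentz, Matrix.mulVec_add, Matrix.mulVec_smul, dotProduct_add, add_dotProduct,
      smul_dotProduct, dotProduct_smul, smul_eq_mul]
    ring
  rw [reflMatrix_mulVec, reflMatrix_mulVec, hadd, h, lorentz_comm α y]
  ring

/-- `W(E₁₀)` acts by Lorentzian isometries. -/
theorem lorentz_rep (w : W) (x y : Fin 11 → ℝ) :
    lorentz (rep w *ᵥ x) (rep w *ᵥ y) = lorentz x y := by
  induction w using cs.simple_induction generalizing x y with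
  | simple i =>
    rw [rep_simple]
    exact lorentz_reflMatrix (by simp [lorentz_simpleRoot]) x y
  | one => simp
  | mul v w hv hw => rw [map_mul, ← Matrix.mulVec_mulVec, ← Matrix.mulVec_mulVec, hv, hw]

/-- `W(A₉)` fixes `e₀`. -/
theorem rep_e_zero {σ : W} (hσ : σ ∈ WA9) : rep σ *ᵥ e 0 = e 0 := by
  induction hσ using Subgroup.closure_induction with
  | mem x hx =>
    obtain ⟨i, hi, rfl⟩ := hx
    obtain ⟨j, rfl⟩ := Fin.exists_succ_eq.2 hi
    rw [rep_simple, reflMatrix_mulVec]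
    have h0 : lorentz (e 0) (simpleRoot j.succ) = 0 := by
      have h1 : (0 : Fin 11) ≠ j.succ.castSucc := by
        rw [Fin.castSucc_succ]
        exact (Fin.succ_ne_zero _).symm
      have h2 : (0 : Fin 11) ≠ j.succ.succ := (Fin.succ_ne_zero _).symm
      rw [simpleRoot, if_neg (Fin.succ_ne_zero j), lorentz_sub_right, lorentz_e, lorentz_e,
        if_neg h1, if_neg h2, sub_zero]
    rw [h0, zero_smul, add_zero]
  | one => simp
  | mul x y _ _ hx hy => rw [map_mul, ← Matrix.mulVec_mulVec, hy, hx]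
  | inv x _ hx =>
    nth_rewrite 1 [← hx]
    rw [Matrix.mulVec_mulVec, ← map_mul, inv_mul_cancel, map_one, Matrix.one_mulVec]

/-- `κ_I` acts on `ℝ^{1,10}` as the reflection in the root `e₀ - eᵢ - eⱼ - eₖ`. -/
theorem rep_kappa (I : Triple) : rep (kappa I) = reflMatrix (tripleRoot I) := by
  obtain ⟨hσ, π, hπ, hI⟩ := (exists_sigma I).choose_spec
  unfold kappa
  generalize (exists_sigma I).choose = σ at hσ hπ
  have hroot : rep σ *ᵥ simpleRoot 0 = tripleRoot I := by
    have h : simpleRoot 0 = e 0 - ∑ a ∈ ({0, 1, 2} : Finset (Fin 10)), e a.succ := by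
      rw [Finset.sum_insert (by decide), Finset.sum_insert (by decide), Finset.sum_singleton]
      simp only [simpleRoot, if_true]
      rw [show (0 : Fin 10).succ = 1 from rfl, show (1 : Fin 10).succ = 2 from rfl,
        show (2 : Fin 10).succ = 3 from rfl]
      abel
    rw [h, Matrix.mulVec_sub, rep_e_zero hσ, Matrix.mulVec_sum, tripleRoot, ← hI,
      Finset.sum_map]
    congr 1
    exact Finset.sum_congr rfl fun a _ => hπ a
  have hinv : ∀ v, rep σ *ᵥ (rep σ⁻¹ *ᵥ v) = v := fun v => by
    rw [Matrix.mulVec_mulVec, ← map_mul, mul_inv_cancel, map_one, Matrix.one_mulVec]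
  have key : ∀ v, rep (σ * cs.simple 0 * σ⁻¹) *ᵥ v = reflMatrix (tripleRoot I) *ᵥ v := by
    intro v
    rw [map_mul, map_mul, ← Matrix.mulVec_mulVec, ← Matrix.mulVec_mulVec, rep_simple,
      reflMatrix_mulVec, reflMatrix_mulVec, Matrix.mulVec_add, Matrix.mulVec_smul, hinv, hroot,
      ← lorentz_rep σ, hinv, hroot]
  exact Matrix.ext_of_mulVec_single fun i => key _

/-- The product `κ_{I₁} κ_{I₂} ⋯ κ_{Iₙ}` of an ordered `n`-tuple of triples. -/
def kappaProd {n : ℕ} (I : Fin n → Triple) : W := (List.ofFn fun a => kappa (I a)).prod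

/-! ### The `s₀`-length, the `s₀`-level and the spectral sets -/

/-- The `s₀`-length: the least number of occurrences of `s₀` in a reduced expression. -/
def s0Length (ω : W) : ℕ :=
  sInf {n | ∃ l : List (Fin 10), cs.IsReduced l ∧ cs.wordProd l = ω ∧ l.count 0 = n}

/-- The `s₀`-level: the least `s₀`-length in the conjugacy class. -/
def s0Level (ω : W) : ℕ := sInf {n | ∃ v : W, IsConj ω v ∧ s0Length v = n}

/-- The ordered `n`-tuples of triples of `s₀`-length `n`. -/
def tuples (n : ℕ) : Set (Fin n → Triple) := {I | s0Length (kappaProd I) = n}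

/-- `𝒟ₙ`: the union of the double cosets `W(A₉) κ_I W(A₉)` over the tuples `I` of `s₀`-length
`n`. One tuple for each double coset suffices, and gives the same union. -/
def D (n : ℕ) : Set W := ⋃ I ∈ tuples n, DoubleCoset.doubleCoset (kappaProd I) WA9 WA9

/-- `𝒟ₙ,ₙ`: the elements of `𝒟ₙ` of `s₀`-level `n`. -/
def Dlevel (n : ℕ) : Set W := {ω ∈ D n | s0Level ω = n}

/-- The spectral set `Λₙ` of the elements of `s₀`-level `n`. -/
def Lam (n : ℕ) : Set ℝ := rho '' Dlevel n

/-- The enlarged spectral set `Λ̃ₙ` of all elements of `𝒟ₙ`. -/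
def LamTilde (n : ℕ) : Set ℝ := rho '' D n

/-- The levelwise maximum `Mₙ = max Λ̃ₙ`. -/
def M (n : ℕ) : ℝ := sSup (LamTilde n)

end E10

end

noncomputable section

namespace E10

/-! ### The deletion property of simply laced Coxeter groups -/

/-! Let `t` be the largest root of `growthPoly`. Everything rests on one vector, `v = extremalVec
t`: it pairs nonpositively with `α₁, …, α₉` and nonnegatively with `α₀`, and `s₀ v = t σ v`, where
`σ ∈ W(A₉)` rotates the ten coordinates by 3.

Upper bound. Reflection in a root `β` adds `(x · β) β`, so vectors are ordered by letting `x` lie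
below its reflection whenever `β` is positive and `x · β ≥ 0`. This order has the lifting property
of the Bruhat order (`BruhatLE.reflect_left`). Hence a letter `s₁, …, s₉` keeps a vector below `tᵐ
v`, a letter `s₀` puts it below `tᵐ⁺¹ v`, and a word with `n` letters `s₀` takes `v` below `tⁿ v`
(`bruhatLE_wordProd`). Positive roots have nonnegative `e₀`-coordinate, so the degree of `w v` is at
most `tⁿ` times that of `v`. Summing over rotations of `v` turns this into a bound for the corner
entry of `rep w`, which controls all entries because `W` preserves the form. Applied to the powers
of `w`, this gives `ρ(w) ≤ tⁿ`.

Sharpness. `(σ⁻¹ s₀)ⁿ` has `v` as eigenvector with eigenvalue `tⁿ`, and moving the factors `σ⁻¹` to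
the right turns its matrix into that of a product of `n` reflections `κ_I` and an element of
`W(A₉)`. As `t > 1`, the upper bound itself shows that no conjugate of that product can be written
with fewer than `n` letters `s₀`, so its `s₀`-level is `n`.

Two structural facts are needed: the deletion property, which lets arbitrary words replace reduced
ones, and the dichotomy that a lattice vector of norm `-2` is positive or negative. Faithfulness of
`rep` is never needed. -/

theorem pow_three_eq_one_of_braid {G : Type*} [Monoid G] {a b : G} (ha : a * a = 1)
    (hb : b * b = 1) (h : a * b * a = b * a * b) : (a * b) ^ 3 = 1 := by
  calc (a * b) ^ 3 = (a * b * a) * (b * a * b) := by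
        simp only [pow_succ, pow_zero, one_mul, mul_assoc]
    _ = (a * b * a) * (a * b * a) := by rw [h]
    _ = a * (b * (a * a) * b) * a := by simp only [mul_assoc]
    _ = 1 := by rw [ha, mul_one, hb, mul_one, ha]

section Deletion

variable {B G : Type*} [Group G] {N : CoxeterMatrix B} (c : CoxeterSystem N G)

theorem simple_braid {i j : B} (h : N i j = 3) :
    c.simple i * c.simple j * c.simple i = c.simple j * c.simple i * c.simple j := by
  have h3 := c.simple_mul_simple_pow i j
  rw [h] at h3
  have : c.simple i * c.simple j * c.simple i * (c.simple j * c.simple i * c.simple j) = 1 := by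
    rw [← h3]; simp only [pow_succ, pow_zero, one_mul, mul_assoc]
  rw [eq_inv_of_mul_eq_one_left this]
  simp [mul_assoc]

theorem simple_comm {i j : B} (h : N i j = 2) :
    c.simple i * c.simple j = c.simple j * c.simple i := by
  have h2 := c.simple_mul_simple_pow i j
  rw [h, pow_two] at h2
  rw [eq_inv_of_mul_eq_one_left h2]
  simp

open Classical in
/-- The indicator of `t = u`, modulo `2`. -/
def eqInd (t u : G) : ZMod 2 := if t = u then 1 else 0

theorem eqInd_conj_simple (i : B) (t u : G) :
    eqInd (c.simple i * t * c.simple i) u = eqInd t (c.simple i * u * c.simple i) := by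
  have h : c.simple i * t * c.simple i = u ↔ t = c.simple i * u * c.simple i := by
    constructor
    · rintro rfl; simp [mul_assoc]
    · rintro rfl; simp [mul_assoc]
  unfold eqInd
  by_cases h' : t = c.simple i * u * c.simple i
  · rw [if_pos h', if_pos (h.2 h')]
  · rw [if_neg h', if_neg fun h1 => h' (h.1 h1)]

/-- The map `(t, ε) ↦ (sᵢ t sᵢ, ε + [t = sᵢ])`. -/
def inversionStep (i : B) (p : G × ZMod 2) : G × ZMod 2 :=
  (c.simple i * p.1 * c.simple i, p.2 + eqInd p.1 (c.simple i))

theorem inversionStep_involutive (i : B) : Function.Involutive (inversionStep c i) := by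
  rintro ⟨t, ε⟩
  simp only [inversionStep, eqInd_conj_simple, Prod.mk.injEq]
  exact ⟨by simp [mul_assoc], by simp [add_assoc, CharTwo.add_self_eq_zero]⟩

theorem inversionStep_braid {i j : B} (h : N i j = 3) (p : G × ZMod 2) :
    inversionStep c i (inversionStep c j (inversionStep c i p)) =
      inversionStep c j (inversionStep c i (inversionStep c j p)) := by
  have hb := simple_braid c h
  obtain ⟨t, ε⟩ := p
  simp only [inversionStep, eqInd_conj_simple, Prod.mk.injEq]
  constructor
  · calc _ = (c.simple i * c.simple j * c.simple i) * t *
          (c.simple i * c.simple j * c.simple i) := by simp only [mul_assoc]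
      _ = (c.simple j * c.simple i * c.simple j) * t *
          (c.simple j * c.simple i * c.simple j) := by rw [hb]
      _ = _ := by simp only [mul_assoc]
  · have h1 : c.simple i * (c.simple j * c.simple i * c.simple j) * c.simple i =
        c.simple j := by rw [← hb]; simp [mul_assoc]
    have h2 : c.simple j * (c.simple i * c.simple j * c.simple i) * c.simple j =
        c.simple i := by rw [hb]; simp [mul_assoc]
    rw [h1, h2, hb]
    abel

theorem inversionStep_comm {i j : B} (h : N i j = 2) (p : G × ZMod 2) :
    inversionStep c i (inversionStep c j p) = inversionStep c j (inversionStep c i p) := by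
  have hc := simple_comm c h
  obtain ⟨t, ε⟩ := p
  simp only [inversionStep, eqInd_conj_simple, Prod.mk.injEq]
  constructor
  · calc _ = (c.simple i * c.simple j) * t * (c.simple j * c.simple i) := by
          simp only [mul_assoc]
      _ = (c.simple j * c.simple i) * t * (c.simple i * c.simple j) := by rw [hc]
      _ = _ := by simp only [mul_assoc]
  · have h1 : c.simple i * c.simple j * c.simple i = c.simple j := by rw [hc]; simp [mul_assoc]
    have h2 : c.simple j * c.simple i * c.simple j = c.simple i := by rw [← hc]; simp [mul_assoc]
    rw [h1, h2]
    abel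

/-- `inversionStep` as a permutation. -/
def inversionPerm (i : B) : Equiv.Perm (G × ZMod 2) := (inversionStep_involutive c i).toPerm

theorem isLiftable_inversionPerm (hN : ∀ i j, i ≠ j → N i j = 2 ∨ N i j = 3) :
    N.IsLiftable (inversionPerm c) := by
  intro i j
  have hs : ∀ k, inversionPerm c k * inversionPerm c k = 1 :=
    fun k => Equiv.ext (inversionStep_involutive c k)
  by_cases hij : i = j
  · subst hij
    simpa using hs i
  rcases hN i j hij with h | h
  · have hf : inversionPerm c i * inversionPerm c j = inversionPerm c j * inversionPerm c i :=
      Equiv.ext (inversionStep_comm c h)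
    rw [h, pow_two]
    nth_rewrite 2 [hf]
    rw [mul_assoc, ← mul_assoc (inversionPerm c j), hs, one_mul, hs]
  · rw [h]
    exact pow_three_eq_one_of_braid (hs i) (hs j) (Equiv.ext (inversionStep_braid c h))

-- The parity with which `t` occurs in the left inversion sequence of a word depends only on the
-- group element, because the steps `inversionStep` satisfy the Coxeter relations.
open Classical in
theorem exists_inversionAction (hN : ∀ i j, i ≠ j → N i j = 2 ∨ N i j = 3) :
    ∃ φ : G → G × ZMod 2 → ZMod 2, ∀ l t ε,
      φ (c.wordProd l) (t, ε) = ε + ((c.leftInvSeq l).count t : ZMod 2) := by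
  let ψ : G →* Equiv.Perm (G × ZMod 2) := c.lift ⟨_, isLiftable_inversionPerm c hN⟩
  -- The inverse makes the first letter of the word act first, as in the recursion of `leftInvSeq`.
  refine ⟨fun w p => (ψ w⁻¹ p).2, fun l => ?_⟩
  induction l with
  | nil =>
    intro t ε
    simp only [c.wordProd_nil, inv_one, map_one, c.leftInvSeq_nil, List.count_nil]
    simp
  | cons i l ih =>
    intro t ε
    change (ψ (c.wordProd (i :: l))⁻¹ (t, ε)).2 = _
    rw [c.wordProd_cons, _root_.mul_inv_rev, map_mul, c.inv_simple]
    change (ψ (c.wordProd l)⁻¹ (ψ (c.simple i) (t, ε))).2 = _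
    rw [show ψ (c.simple i) = inversionPerm c i from
      c.lift_apply_simple (isLiftable_inversionPerm c hN) i]
    change (ψ (c.wordProd l)⁻¹ (inversionStep c i (t, ε))).2 = _
    have hc : (List.map (MulAut.conj (c.simple i)) (c.leftInvSeq l)).count t =
        (c.leftInvSeq l).count (c.simple i * t * c.simple i) := by
      conv_lhs => rw [show t = MulAut.conj (c.simple i) (c.simple i * t * c.simple i) by
        simp [mul_assoc]]
      exact List.count_map_of_injective _ _ (MulEquiv.injective _) _
    refine (ih _ _).trans ?_
    rw [CoxeterSystem.leftInvSeq, List.count_cons, hc]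
    by_cases h : t = c.simple i
    · simp [h, eqInd]; ring
    · simp [h, Ne.symm h, eqInd]

/-- A reduced word of the same element that starts with `i` has `sᵢ` exactly once in its inversion
sequence. By parity `sᵢ` occurs in the inversion sequence of `l`, and its position is the letter to
erase. -/
theorem exchange (hN : ∀ i j, i ≠ j → N i j = 2 ∨ N i j = 3) {l : List B} {i : B}
    (h : c.IsLeftDescent (c.wordProd l) i) :
    ∃ j < l.length, c.simple i * c.wordProd l = c.wordProd (l.eraseIdx j) := by
  classical
  obtain ⟨φ, hφ⟩ := exists_inversionAction c hN
  obtain ⟨l', hl', hw⟩ := c.exists_isReduced (c.simple i * c.wordProd l)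
  have hprod : c.wordProd l = c.wordProd (i :: l') := by
    rw [c.wordProd_cons, ← hw]; simp
  have hred : c.IsReduced (i :: l') := by
    have h1 := c.isLeftDescent_iff.1 h
    rw [hw, hl'.eq] at h1
    rw [CoxeterSystem.IsReduced, ← hprod, ← h1]; rfl
  have hcount : (c.leftInvSeq (i :: l')).count (c.simple i) = 1 :=
    List.count_eq_one_of_mem hred.nodup_leftInvSeq (by simp [CoxeterSystem.leftInvSeq])
  have h1 := hφ l (c.simple i) 0
  rw [hprod, hφ, hcount] at h1
  have hmem : c.simple i ∈ c.leftInvSeq l := by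
    by_contra hn
    rw [List.count_eq_zero_of_not_mem hn] at h1
    simp at h1
  obtain ⟨j, hj, hji⟩ := List.getElem_of_mem hmem
  refine ⟨j, by rwa [c.length_leftInvSeq] at hj, ?_⟩
  rw [← c.getD_leftInvSeq_mul_wordProd, List.getD_eq_getElem _ _ hj, hji]

theorem exists_reduced_sublist (hN : ∀ i j, i ≠ j → N i j = 2 ∨ N i j = 3) (l : List B) :
    ∃ l', l'.Sublist l ∧ c.IsReduced l' ∧ c.wordProd l' = c.wordProd l := by
  induction l with
  | nil => exact ⟨[], List.Sublist.refl _, by simp [CoxeterSystem.IsReduced], rfl⟩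
  | cons i l ih =>
    obtain ⟨l', hs, hr, hp⟩ := ih
    by_cases h : c.IsLeftDescent (c.wordProd l') i
    · obtain ⟨j, hj, he⟩ := exchange c hN h
      refine ⟨l'.eraseIdx j, ((List.eraseIdx_sublist _ _).trans hs).trans
        (List.sublist_cons_self _ _), ?_, by rw [← he, c.wordProd_cons, hp]⟩
      have h1 := c.isLeftDescent_iff.1 h
      rw [he, hr.eq] at h1
      rw [CoxeterSystem.IsReduced, List.length_eraseIdx_of_lt hj]
      omega
    · refine ⟨i :: l', hs.cons_cons i, ?_, by rw [c.wordProd_cons, c.wordProd_cons, hp]⟩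
      rw [CoxeterSystem.IsReduced, c.wordProd_cons, c.not_isLeftDescent_iff.1 h, hr.eq]
      rfl

end Deletion

theorem coxeterMatrix_eq_two_or_three (i j : Fin 10) (h : i ≠ j) :
    coxeterMatrix i j = 2 ∨ coxeterMatrix i j = 3 := by
  have h1 : coxeterMatrix i j = if i = j then 1 else if Adj i j then 3 else 2 := rfl
  rw [h1, if_neg h]
  split_ifs <;> simp

/-- Deleting letters down to a reduced word cannot create new letters `s₀`. -/
theorem s0Length_wordProd_le (l : List (Fin 10)) : s0Length (cs.wordProd l) ≤ l.count 0 := by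
  obtain ⟨l', hs, hr, hp⟩ := exists_reduced_sublist cs coxeterMatrix_eq_two_or_three l
  have h : s0Length (cs.wordProd l) ≤ l'.count 0 := Nat.sInf_le ⟨l', hr, hp, rfl⟩
  exact h.trans (hs.count_le 0)

theorem exists_word_of_s0Length (ω : W) :
    ∃ l : List (Fin 10), cs.wordProd l = ω ∧ l.count 0 = s0Length ω := by
  have hne : {n | ∃ l : List (Fin 10), cs.IsReduced l ∧ cs.wordProd l = ω ∧
      l.count 0 = n}.Nonempty := by
    obtain ⟨l, hl, h⟩ := cs.exists_isReduced ω
    exact ⟨_, l, hl, h.symm, rfl⟩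
  obtain ⟨l, -, h, h'⟩ := Nat.sInf_mem hne
  exact ⟨l, h, h'⟩

/-! ### Positive roots -/

theorem lorentz_add_left (x y z : Fin 11 → ℝ) :
    lorentz (x + y) z = lorentz x z + lorentz y z := by
  simp [lorentz, add_dotProduct]

theorem lorentz_smul_left (r : ℝ) (x y : Fin 11 → ℝ) : lorentz (r • x) y = r * lorentz x y := by
  simp [lorentz, smul_dotProduct]

theorem lorentz_smul_right (r : ℝ) (x y : Fin 11 → ℝ) : lorentz x (r • y) = r * lorentz x y := by
  simp [lorentz, Matrix.mulVec_smul, dotProduct_smul]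

theorem lorentz_sum_left {ι : Type*} (s : Finset ι) (f : ι → Fin 11 → ℝ) (y : Fin 11 → ℝ) :
    lorentz (∑ i ∈ s, f i) y = ∑ i ∈ s, lorentz (f i) y := by
  simp [lorentz, sum_dotProduct]

/-- The element `∑ cᵢ αᵢ` of the root lattice. -/
def latticeVec (c : Fin 10 → ℤ) : Fin 11 → ℝ := ∑ i, (c i : ℝ) • simpleRoot i

/-- The quadratic form of the root lattice: half the negative of the Lorentzian norm. -/
def quad (c : Fin 10 → ℤ) : ℤ :=
  c 0 ^ 2 + c 1 ^ 2 + c 2 ^ 2 + c 3 ^ 2 + c 4 ^ 2 + c 5 ^ 2 + c 6 ^ 2 + c 7 ^ 2 + c 8 ^ 2 + c 9 ^ 2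
    - c 0 * c 3 - c 1 * c 2 - c 2 * c 3 - c 3 * c 4 - c 4 * c 5 - c 5 * c 6 - c 6 * c 7 - c 7 * c 8
    - c 8 * c 9

/-- The pairing of `∑ cᵢ αᵢ` with a simple root. -/
def pairing (c : Fin 10 → ℤ) (i : Fin 10) : ℤ :=
  ∑ j, c j * if j = i then -2 else if Adj j i then 1 else 0

theorem lorentz_latticeVec_simpleRoot (c : Fin 10 → ℤ) (i : Fin 10) :
    lorentz (latticeVec c) (simpleRoot i) = pairing c i := by
  rw [latticeVec, lorentz_sum_left, pairing]
  push_cast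
  refine Finset.sum_congr rfl fun j _ => ?_
  rw [lorentz_smul_left, lorentz_simpleRoot]

theorem lorentz_latticeVec (c : Fin 10 → ℤ) :
    lorentz (latticeVec c) (latticeVec c) = -2 * (quad c : ℝ) := by
  have h : (∑ i, c i * pairing c i : ℤ) = -2 * quad c := by
    simp +decide [pairing, quad, Fin.sum_univ_succ, Adj, Fin.succ_ne_zero]
    ring
  have h' : lorentz (latticeVec c) (latticeVec c) = ∑ i, (c i : ℝ) * pairing c i := by
    nth_rewrite 1 [latticeVec]
    rw [lorentz_sum_left]
    refine Finset.sum_congr rfl fun j _ => ?_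
    rw [lorentz_smul_left, lorentz_comm, lorentz_latticeVec_simpleRoot]
  rw [h']
  exact_mod_cast h

/-- Without node 9 the diagram is affine `E₉`. If `x₁, …, x₁₀` are the coordinates of the lattice
vector along `e₁, …, e₁₀`, then `x₁₀ = 0` and `x₁ + ⋯ + x₉ = -3c₀`, so `2 quad c = ∑ xₐ² - c₀²` is
the sum of the nine squares `(xₐ + c₀/3)²`. -/
theorem quad_nonneg_of_nine (c : Fin 10 → ℤ) (h : c 9 = 0) : 0 ≤ quad c := by
  unfold quad
  rw [h]
  linarith [sq_nonneg (3 * c 1 - 2 * c 0), sq_nonneg (3 * (c 2 - c 1) - 2 * c 0),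
    sq_nonneg (3 * (c 3 - c 2) - 2 * c 0), sq_nonneg (3 * (c 4 - c 3) + c 0),
    sq_nonneg (3 * (c 5 - c 4) + c 0), sq_nonneg (3 * (c 6 - c 5) + c 0),
    sq_nonneg (3 * (c 7 - c 6) + c 0), sq_nonneg (3 * (c 8 - c 7) + c 0),
    sq_nonneg (3 * (- c 8) + c 0)]

theorem eq_zero_of_sum_sq_nonpos (l : List ℤ) (h : (l.map (· ^ 2)).sum ≤ 0) : ∀ y ∈ l, y = 0 := by
  induction l with
  | nil => simp
  | cons a l ih =>
    have h0 : 0 ≤ (l.map (· ^ 2)).sum := List.sum_nonneg (by simp; intros; positivity)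
    rw [List.map_cons, List.sum_cons] at h
    intro y hy
    rcases List.mem_cons.1 hy with rfl | hy
    · exact pow_eq_zero_iff two_ne_zero |>.1 (le_antisymm (by linarith) (sq_nonneg y))
    · exact ih (by linarith [sq_nonneg a]) y hy

/-- The quadratic form is definite on vectors whose support avoids one of the nodes `0, …, 8`. -/
theorem eq_zero_of_quad_nonpos (c : Fin 10 → ℤ) (j : Fin 10) (hj : j ≠ 9) (h : c j = 0)
    (hq : quad c ≤ 0) : c = 0 := by
  unfold quad at hq
  have hc : ∀ k : Fin 10, c k = 0 := by
    -- With `xₐ` the coordinates along `eₐ`, `2 quad c = ∑ xₐ² - c₀²`. For `j ≥ 3`, `cⱼ = 0` gives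
    -- `x₁ + ⋯ + xⱼ = -3c₀`; after scaling by `j²`, the squares `(j xₐ + 3c₀)²` for `a ≤ j` leave
    -- over `j(9 - j)c₀²`, positive unless `c₀ = 0`. The cases `j ≤ 2` are analogous.
    fin_cases j
    · replace h : c 0 = 0 := h
      rw [h] at hq
      have hz := eq_zero_of_sum_sq_nonpos [c 1 - c 0, c 2 - c 1 - c 0, c 3 - c 2 - c 0,
        c 4 - c 3, c 5 - c 4, c 6 - c 5, c 7 - c 6, c 8 - c 7, c 9 - c 8, c 9]
        (by simp only [List.map_cons, List.map_nil, List.sum_cons, List.sum_nil, h]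
            linarith [sq_nonneg (c 0)])
      simp only [List.forall_mem_cons] at hz
      intro k
      fin_cases k <;> simp only [Fin.reduceFinMk, Fin.zero_eta, Fin.mk_one] <;> omega
    · replace h : c 1 = 0 := h
      rw [h] at hq
      have hz := eq_zero_of_sum_sq_nonpos [c 2 - c 1 - c 0, c 3 - c 2 - c 0, c 4 - c 3,
        c 5 - c 4, c 6 - c 5, c 7 - c 6, c 8 - c 7, c 9 - c 8, c 9]
        (by simp only [List.map_cons, List.map_nil, List.sum_cons, List.sum_nil, h]
            linarith [sq_nonneg (c 0)])
      simp only [List.forall_mem_cons] at hz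
      intro k
      fin_cases k <;> simp only [Fin.reduceFinMk, Fin.zero_eta, Fin.mk_one] <;> omega
    · replace h : c 2 = 0 := h
      rw [h] at hq
      have hz := eq_zero_of_sum_sq_nonpos [c 0, (c 1 - c 0) + c 0, (c 2 - c 1 - c 0) + c 0,
        c 3 - c 2 - c 0, c 4 - c 3, c 5 - c 4, c 6 - c 5, c 7 - c 6, c 8 - c 7, c 9 - c 8, c 9]
        (by simp only [List.map_cons, List.map_nil, List.sum_cons, List.sum_nil, h]
            linarith [sq_nonneg (c 0)])
      simp only [List.forall_mem_cons] at hz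
      intro k
      fin_cases k <;> simp only [Fin.reduceFinMk, Fin.zero_eta, Fin.mk_one] <;> omega
    · replace h : c 3 = 0 := h
      rw [h] at hq
      have hz := eq_zero_of_sum_sq_nonpos [c 0, 3 * (c 1 - c 0) + 3 * c 0,
        3 * (c 2 - c 1 - c 0) + 3 * c 0, 3 * (c 3 - c 2 - c 0) + 3 * c 0, 3 * (c 4 - c 3),
        3 * (c 5 - c 4), 3 * (c 6 - c 5), 3 * (c 7 - c 6), 3 * (c 8 - c 7), 3 * (c 9 - c 8),
        3 * c 9]
        (by simp only [List.map_cons, List.map_nil, List.sum_cons, List.sum_nil, h]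
            linarith [sq_nonneg (c 0)])
      simp only [List.forall_mem_cons] at hz
      intro k
      fin_cases k <;> simp only [Fin.reduceFinMk, Fin.zero_eta, Fin.mk_one] <;> omega
    · replace h : c 4 = 0 := h
      rw [h] at hq
      have hz := eq_zero_of_sum_sq_nonpos [c 0, 4 * (c 1 - c 0) + 3 * c 0,
        4 * (c 2 - c 1 - c 0) + 3 * c 0, 4 * (c 3 - c 2 - c 0) + 3 * c 0,
        4 * (c 4 - c 3) + 3 * c 0, 4 * (c 5 - c 4), 4 * (c 6 - c 5), 4 * (c 7 - c 6),
        4 * (c 8 - c 7), 4 * (c 9 - c 8), 4 * c 9]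
        (by simp only [List.map_cons, List.map_nil, List.sum_cons, List.sum_nil, h]
            linarith [sq_nonneg (c 0)])
      simp only [List.forall_mem_cons] at hz
      intro k
      fin_cases k <;> simp only [Fin.reduceFinMk, Fin.zero_eta, Fin.mk_one] <;> omega
    · replace h : c 5 = 0 := h
      rw [h] at hq
      have hz := eq_zero_of_sum_sq_nonpos [c 0, 5 * (c 1 - c 0) + 3 * c 0,
        5 * (c 2 - c 1 - c 0) + 3 * c 0, 5 * (c 3 - c 2 - c 0) + 3 * c 0,
        5 * (c 4 - c 3) + 3 * c 0, 5 * (c 5 - c 4) + 3 * c 0, 5 * (c 6 - c 5), 5 * (c 7 - c 6),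
        5 * (c 8 - c 7), 5 * (c 9 - c 8), 5 * c 9]
        (by simp only [List.map_cons, List.map_nil, List.sum_cons, List.sum_nil, h]
            linarith [sq_nonneg (c 0)])
      simp only [List.forall_mem_cons] at hz
      intro k
      fin_cases k <;> simp only [Fin.reduceFinMk, Fin.zero_eta, Fin.mk_one] <;> omega
    · replace h : c 6 = 0 := h
      rw [h] at hq
      have hz := eq_zero_of_sum_sq_nonpos [c 0, 6 * (c 1 - c 0) + 3 * c 0,
        6 * (c 2 - c 1 - c 0) + 3 * c 0, 6 * (c 3 - c 2 - c 0) + 3 * c 0,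
        6 * (c 4 - c 3) + 3 * c 0, 6 * (c 5 - c 4) + 3 * c 0, 6 * (c 6 - c 5) + 3 * c 0,
        6 * (c 7 - c 6), 6 * (c 8 - c 7), 6 * (c 9 - c 8), 6 * c 9]
        (by simp only [List.map_cons, List.map_nil, List.sum_cons, List.sum_nil, h]
            linarith [sq_nonneg (c 0)])
      simp only [List.forall_mem_cons] at hz
      intro k
      fin_cases k <;> simp only [Fin.reduceFinMk, Fin.zero_eta, Fin.mk_one] <;> omega
    · replace h : c 7 = 0 := h
      rw [h] at hq
      have hz := eq_zero_of_sum_sq_nonpos [c 0, 7 * (c 1 - c 0) + 3 * c 0,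
        7 * (c 2 - c 1 - c 0) + 3 * c 0, 7 * (c 3 - c 2 - c 0) + 3 * c 0,
        7 * (c 4 - c 3) + 3 * c 0, 7 * (c 5 - c 4) + 3 * c 0, 7 * (c 6 - c 5) + 3 * c 0,
        7 * (c 7 - c 6) + 3 * c 0, 7 * (c 8 - c 7), 7 * (c 9 - c 8), 7 * c 9]
        (by simp only [List.map_cons, List.map_nil, List.sum_cons, List.sum_nil, h]
            linarith [sq_nonneg (c 0)])
      simp only [List.forall_mem_cons] at hz
      intro k
      fin_cases k <;> simp only [Fin.reduceFinMk, Fin.zero_eta, Fin.mk_one] <;> omega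
    · replace h : c 8 = 0 := h
      rw [h] at hq
      have hz := eq_zero_of_sum_sq_nonpos [c 0, 8 * (c 1 - c 0) + 3 * c 0,
        8 * (c 2 - c 1 - c 0) + 3 * c 0, 8 * (c 3 - c 2 - c 0) + 3 * c 0,
        8 * (c 4 - c 3) + 3 * c 0, 8 * (c 5 - c 4) + 3 * c 0, 8 * (c 6 - c 5) + 3 * c 0,
        8 * (c 7 - c 6) + 3 * c 0, 8 * (c 8 - c 7) + 3 * c 0, 8 * (c 9 - c 8), 8 * c 9]
        (by simp only [List.map_cons, List.map_nil, List.sum_cons, List.sum_nil, h]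
            linarith [sq_nonneg (c 0)])
      simp only [List.forall_mem_cons] at hz
      intro k
      fin_cases k <;> simp only [Fin.reduceFinMk, Fin.zero_eta, Fin.mk_one] <;> omega
    · exact absurd rfl hj
  exact funext hc

theorem one_le_quad {c : Fin 10 → ℤ} (hc : c ≠ 0) {j : Fin 10} (hj : j ≠ 9) (h : c j = 0) :
    1 ≤ quad c := by
  by_contra hq
  exact hc (eq_zero_of_quad_nonpos c j hj h (by omega))

/-- The case not covered by definiteness: `n` lives on node 9 alone, and the edge from 8 to 9
contributes `p₈ n₉ ≥ 1` on top of `n₉² ≥ 1`. -/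
theorem two_le_quad_sub_of_pos {p n : Fin 10 → ℤ} (hp : ∀ i, 0 ≤ p i) (hn : ∀ i, 0 ≤ n i)
    (hpn : ∀ i, p i * n i = 0) (hn0 : n ≠ 0) (h : ∀ j, j ≠ 9 → p j ≠ 0) :
    2 ≤ quad (p - n) := by
  have hnj : ∀ j, j ≠ 9 → n j = 0 := fun j hj => (mul_eq_zero.1 (hpn j)).resolve_left (h j hj)
  have hn9 : 1 ≤ n 9 := by
    rcases (hn 9).lt_or_eq with h9 | h9
    · exact h9
    · refine absurd (funext fun j => ?_) hn0
      by_cases hj : j = 9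
      · rw [hj, ← h9]; rfl
      · exact hnj j hj
  have hp9 : p 9 = 0 := (mul_eq_zero.1 (hpn 9)).resolve_right (by omega)
  have hp8 : 1 ≤ p 8 := lt_of_le_of_ne (hp 8) (h 8 (by decide)).symm
  have hq := quad_nonneg_of_nine p hp9
  have he : quad (p - n) = quad p + n 9 ^ 2 + p 8 * n 9 := by
    simp only [quad, Pi.sub_apply, hnj 0 (by decide), hnj 1 (by decide), hnj 2 (by decide),
      hnj 3 (by decide), hnj 4 (by decide), hnj 5 (by decide), hnj 6 (by decide),
      hnj 7 (by decide), hnj 8 (by decide), hp9]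
    ring
  rw [he]
  nlinarith

/-- For disjoint supports the cross terms come only from edges of the diagram, and they enter with a
positive sign. -/
theorem quad_add_quad_le {p n : Fin 10 → ℤ} (hp : ∀ i, 0 ≤ p i) (hn : ∀ i, 0 ≤ n i)
    (hpn : ∀ i, p i * n i = 0) : quad p + quad n ≤ quad (p - n) := by
  have h : ∀ i j, 0 ≤ p i * n j := fun i j => mul_nonneg (hp i) (hn j)
  simp only [quad, Pi.sub_apply]
  linarith [hpn 0, hpn 1, hpn 2, hpn 3, hpn 4, hpn 5, hpn 6, hpn 7, hpn 8, hpn 9, h 0 3, h 3 0,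
    h 1 2, h 2 1, h 2 3, h 3 2, h 3 4, h 4 3, h 4 5, h 5 4, h 5 6, h 6 5, h 6 7, h 7 6, h 7 8,
    h 8 7, h 8 9, h 9 8]

theorem quad_neg (c : Fin 10 → ℤ) : quad (-c) = quad c := by
  simp only [quad, Pi.neg_apply]; ring

/-- Every root is positive or negative. -/
theorem nonneg_or_nonpos_of_quad_eq_one {c : Fin 10 → ℤ} (hc : quad c = 1) :
    (∀ i, 0 ≤ c i) ∨ ∀ i, c i ≤ 0 := by
  by_contra! hcon
  obtain ⟨⟨a, ha⟩, b, hb⟩ := hcon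
  have hcpn : c = c⁺ - c⁻ := (posPart_sub_negPart c).symm
  have hpi : ∀ i, c⁺ i = max (c i) 0 := fun i => rfl
  have hni : ∀ i, c⁻ i = max (-c i) 0 := fun i => rfl
  generalize c⁺ = p at *
  generalize c⁻ = n at *
  have hp : ∀ i, 0 ≤ p i := fun i => by rw [hpi]; exact le_max_right _ _
  have hn : ∀ i, 0 ≤ n i := fun i => by rw [hni]; exact le_max_right _ _
  have hpn : ∀ i, p i * n i = 0 := fun i => by
    rw [hpi, hni, mul_eq_zero]; omega
  have hp0 : p ≠ 0 := fun h0 => by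
    have h1 := congrFun h0 b
    rw [hpi] at h1
    simp at h1
    omega
  have hn0 : n ≠ 0 := fun h0 => by
    have h1 := congrFun h0 a
    rw [hni] at h1
    simp at h1
    omega
  have hsum := quad_add_quad_le hp hn hpn
  rw [← hcpn, hc] at hsum
  by_cases h1 : ∃ j, j ≠ 9 ∧ p j = 0
  · by_cases h2 : ∃ j, j ≠ 9 ∧ n j = 0
    · obtain ⟨j, hj, hj'⟩ := h1
      obtain ⟨k, hk, hk'⟩ := h2
      have := one_le_quad hp0 hj hj'
      have := one_le_quad hn0 hk hk'
      omega
    · push Not at h2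
      have := two_le_quad_sub_of_pos hn hp (fun i => by rw [mul_comm]; exact hpn i) hp0 h2
      rw [← neg_sub, quad_neg, ← hcpn, hc] at this
      omega
  · push Not at h1
    have := two_le_quad_sub_of_pos hp hn hpn hn0 h1
    rw [← hcpn, hc] at this
    omega

/-- The positive roots. -/
def IsPosRoot (β : Fin 11 → ℝ) : Prop :=
  ∃ c : Fin 10 → ℤ, (∀ i, 0 ≤ c i) ∧ β = latticeVec c ∧ lorentz β β = -2

theorem lorentz_simpleRoot_self (i : Fin 10) : lorentz (simpleRoot i) (simpleRoot i) = -2 := by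
  simp [lorentz_simpleRoot]

theorem latticeVec_single (i : Fin 10) (m : ℤ) :
    latticeVec (Pi.single i m) = (m : ℝ) • simpleRoot i := by
  rw [latticeVec, Finset.sum_eq_single i]
  · simp
  · intro j _ hj; simp [hj]
  · simp

theorem latticeVec_add (c d : Fin 10 → ℤ) :
    latticeVec (c + d) = latticeVec c + latticeVec d := by
  simp [latticeVec, add_smul, Finset.sum_add_distrib]

theorem isPosRoot_simpleRoot (i : Fin 10) : IsPosRoot (simpleRoot i) := by
  refine ⟨Pi.single i 1, fun j => ?_, ?_, lorentz_simpleRoot_self i⟩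
  · by_cases h : j = i
    · subst h; simp
    · simp [h]
  · rw [latticeVec_single]; simp

/-- A simple reflection permutes the positive roots other than its own simple root. -/
theorem IsPosRoot.reflect {β : Fin 11 → ℝ} (hβ : IsPosRoot β) {i : Fin 10}
    (hi : β ≠ simpleRoot i) : IsPosRoot (reflMatrix (simpleRoot i) *ᵥ β) := by
  obtain ⟨c, hc, rfl, hn⟩ := hβ
  have he : reflMatrix (simpleRoot i) *ᵥ latticeVec c =
      latticeVec (c + Pi.single i (pairing c i)) := by
    rw [reflMatrix_mulVec, lorentz_latticeVec_simpleRoot, latticeVec_add, latticeVec_single]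
  have hn' : lorentz (reflMatrix (simpleRoot i) *ᵥ latticeVec c)
      (reflMatrix (simpleRoot i) *ᵥ latticeVec c) = -2 := by
    rw [lorentz_reflMatrix (lorentz_simpleRoot_self i), hn]
  have hquad : ∀ d, lorentz (latticeVec d) (latticeVec d) = -2 → quad d = 1 := by
    intro d hd
    rw [lorentz_latticeVec] at hd
    have : (quad d : ℝ) = 1 := by linarith
    exact_mod_cast this
  refine ⟨_, ?_, he, hn'⟩
  rw [he] at hn'
  -- Only the `i`-th coefficient changes, so a nonpositive result makes the root a multiple of `αᵢ`,
  -- and its norm makes it `αᵢ`.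
  refine (nonneg_or_nonpos_of_quad_eq_one (hquad _ hn')).resolve_right fun hneg => ?_
  have hz : ∀ j, j ≠ i → c j = 0 := fun j hj => by
    have := hneg j
    rw [Pi.add_apply, Pi.single_eq_of_ne hj, add_zero] at this
    exact le_antisymm this (hc j)
  have hcs : c = Pi.single i (c i) := by
    funext j
    by_cases hj : j = i
    · subst hj; simp
    · rw [Pi.single_eq_of_ne hj, hz j hj]
  rw [hcs, latticeVec_single, lorentz_smul_left, lorentz_smul_right,
    lorentz_simpleRoot_self] at hn
  have h1 : (c i : ℝ) = 1 := by
    have h0 : (0 : ℝ) ≤ c i := by exact_mod_cast hc i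
    nlinarith
  apply hi
  rw [hcs, latticeVec_single, h1, one_smul]

/-! ### The Bruhat order on `ℝ^{1,10}` -/

/-- `y` is obtained from `x` by a reflection that adds a nonnegative multiple of a positive
root. -/
def BruhatStep (x y : Fin 11 → ℝ) : Prop :=
  ∃ β, IsPosRoot β ∧ 0 ≤ lorentz x β ∧ y = reflMatrix β *ᵥ x

/-- The order generated by `BruhatStep`. -/
def BruhatLE : (Fin 11 → ℝ) → (Fin 11 → ℝ) → Prop := Relation.ReflTransGen BruhatStep

theorem reflMatrix_simpleRoot_involutive (i : Fin 10) (x : Fin 11 → ℝ) :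
    reflMatrix (simpleRoot i) *ᵥ (reflMatrix (simpleRoot i) *ᵥ x) = x := by
  rw [Matrix.mulVec_mulVec, reflMatrix_mul_self (lorentz_simpleRoot_self i), Matrix.one_mulVec]

theorem lorentz_reflMatrix_simpleRoot (i : Fin 10) (x : Fin 11 → ℝ) :
    lorentz (reflMatrix (simpleRoot i) *ᵥ x) (simpleRoot i) = -lorentz x (simpleRoot i) := by
  rw [reflMatrix_mulVec, lorentz_add_left, lorentz_smul_left, lorentz_simpleRoot_self]
  ring

theorem BruhatStep.reflect {x y : Fin 11 → ℝ} (h : BruhatStep x y) (i : Fin 10) :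
    BruhatStep (reflMatrix (simpleRoot i) *ᵥ x) (reflMatrix (simpleRoot i) *ᵥ y) ∨
      y = reflMatrix (simpleRoot i) *ᵥ x := by
  obtain ⟨β, hβ, hx, rfl⟩ := h
  by_cases hi : β = simpleRoot i
  · right; rw [hi]
  · left
    have hiso := lorentz_reflMatrix (lorentz_simpleRoot_self i)
    refine ⟨_, hβ.reflect hi, by rwa [hiso], ?_⟩
    rw [reflMatrix_mulVec β, reflMatrix_mulVec (reflMatrix (simpleRoot i) *ᵥ β), hiso,
      Matrix.mulVec_add, Matrix.mulVec_smul]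

/-- The lifting property: `sᵢ` carries a chain from `x` to `y` step by step to a chain ending at `sᵢ
y`, which is below `y`, unless some step is along `αᵢ`; from there the original chain serves. -/
theorem BruhatLE.reflect_left {x y : Fin 11 → ℝ} (h : BruhatLE x y) {i : Fin 10}
    (hy : lorentz y (simpleRoot i) ≤ 0) : BruhatLE (reflMatrix (simpleRoot i) *ᵥ x) y := by
  induction h using Relation.ReflTransGen.head_induction_on with
  | refl =>
    refine Relation.ReflTransGen.single ⟨_, isPosRoot_simpleRoot i, ?_, ?_⟩
    · rw [lorentz_reflMatrix_simpleRoot]; linarith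
    · rw [reflMatrix_simpleRoot_involutive]
  | head hs hr ih =>
    rcases hs.reflect i with h | h
    · exact Relation.ReflTransGen.head h ih
    · rw [← h]; exact hr

theorem BruhatLE.reflect {x y : Fin 11 → ℝ} (h : BruhatLE x y) {i : Fin 10}
    (hy : 0 ≤ lorentz y (simpleRoot i)) :
    BruhatLE (reflMatrix (simpleRoot i) *ᵥ x) (reflMatrix (simpleRoot i) *ᵥ y) := by
  refine BruhatLE.reflect_left
    (Relation.ReflTransGen.tail h ⟨_, isPosRoot_simpleRoot i, hy, rfl⟩) ?_
  rw [lorentz_reflMatrix_simpleRoot]; linarith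

theorem simpleRoot_apply_zero (i : Fin 10) : simpleRoot i 0 = if i = 0 then 1 else 0 := by
  fin_cases i <;> simp [simpleRoot, e]

theorem IsPosRoot.apply_zero_nonneg {β : Fin 11 → ℝ} (hβ : IsPosRoot β) : 0 ≤ β 0 := by
  obtain ⟨c, hc, rfl, -⟩ := hβ
  rw [latticeVec, Finset.sum_apply]
  refine Finset.sum_nonneg fun i _ => ?_
  rw [Pi.smul_apply, simpleRoot_apply_zero, smul_eq_mul]
  have : (0 : ℝ) ≤ c i := by exact_mod_cast hc i
  split_ifs <;> simp [this]

theorem BruhatLE.apply_zero_le {x y : Fin 11 → ℝ} (h : BruhatLE x y) : x 0 ≤ y 0 := by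
  induction h with
  | refl => exact le_rfl
  | tail _ hs ih =>
    obtain ⟨β, hβ, hx, rfl⟩ := hs
    rw [reflMatrix_mulVec, Pi.add_apply, Pi.smul_apply, smul_eq_mul]
    linarith [mul_nonneg hx hβ.apply_zero_nonneg]

/-! ### Greedy growth -/

theorem exists_word_of_mem_WA9 {σ : W} (hσ : σ ∈ WA9) :
    ∃ l : List (Fin 10), cs.wordProd l = σ ∧ l.count 0 = 0 := by
  induction hσ using Subgroup.closure_induction with
  | mem x hx =>
    obtain ⟨i, hi, rfl⟩ := hx
    exact ⟨[i], cs.wordProd_singleton i, by simp [hi]⟩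
  | one => exact ⟨[], cs.wordProd_nil, rfl⟩
  | mul x y _ _ hx hy =>
    obtain ⟨l, rfl, hl⟩ := hx
    obtain ⟨m, rfl, hm⟩ := hy
    exact ⟨l ++ m, cs.wordProd_append l m, by rw [List.count_append, hl, hm]⟩
  | inv x _ hx =>
    obtain ⟨l, rfl, hl⟩ := hx
    exact ⟨l.reverse, cs.wordProd_reverse l, by rwa [List.count_reverse]⟩

theorem rep_wordProd_cons (i : Fin 10) (l : List (Fin 10)) (x : Fin 11 → ℝ) :
    rep (cs.wordProd (i :: l)) *ᵥ x =
      reflMatrix (simpleRoot i) *ᵥ (rep (cs.wordProd l) *ᵥ x) := by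
  rw [cs.wordProd_cons, map_mul, rep_simple, Matrix.mulVec_mulVec]

theorem BruhatLE.rep_WA9 {x y : Fin 11 → ℝ} (h : BruhatLE x y)
    (hy : ∀ i : Fin 10, i ≠ 0 → lorentz y (simpleRoot i) ≤ 0) {σ : W} (hσ : σ ∈ WA9) :
    BruhatLE (rep σ *ᵥ x) y := by
  obtain ⟨l, rfl, hl⟩ := exists_word_of_mem_WA9 hσ
  clear hσ
  induction l with
  | nil => simpa using h
  | cons i l ih =>
    rw [List.count_cons] at hl
    have hi : i ≠ 0 := by rintro rfl; simp at hl
    rw [rep_wordProd_cons]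
    exact (ih (by omega)).reflect_left (hy i hi)

/-- If `v` is `A₉`-antidominant and `s₀ v` is `t` times a permutation of `v`, then a word with `n`
letters `s₀` takes `v` to a vector below `tⁿ v`. -/
theorem bruhatLE_wordProd {v : Fin 11 → ℝ} {t : ℝ} (ht : 0 ≤ t)
    (hv : ∀ i : Fin 10, i ≠ 0 → lorentz v (simpleRoot i) ≤ 0)
    (hv0 : 0 ≤ lorentz v (simpleRoot 0)) {σ : W} (hσ : σ ∈ WA9)
    (he : reflMatrix (simpleRoot 0) *ᵥ v = t • (rep σ *ᵥ v)) (l : List (Fin 10)) :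
    BruhatLE (rep (cs.wordProd l) *ᵥ v) (t ^ l.count 0 • v) := by
  have hneg : ∀ n : ℕ, ∀ i : Fin 10, i ≠ 0 → lorentz (t ^ n • v) (simpleRoot i) ≤ 0 := by
    intro n i hi
    rw [lorentz_smul_left]
    exact mul_nonpos_of_nonneg_of_nonpos (pow_nonneg ht n) (hv i hi)
  induction l with
  | nil =>
    have h : BruhatLE v v := Relation.ReflTransGen.refl
    simpa using h
  | cons i l ih =>
    rw [rep_wordProd_cons, List.count_cons]
    by_cases hi : i = 0
    · subst hi
      simp only [beq_self_eq_true, if_true]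
      -- `s₀` maps the upper bound `tᵐ v` to `tᵐ⁺¹ σ v`, which antidominance puts below `tᵐ⁺¹ v`.
      have h1 := ih.reflect (i := 0) (by
        rw [lorentz_smul_left]; exact mul_nonneg (pow_nonneg ht _) hv0)
      rw [Matrix.mulVec_smul, he, smul_smul, ← pow_succ, ← Matrix.mulVec_smul] at h1
      exact h1.trans (BruhatLE.rep_WA9 Relation.ReflTransGen.refl (hneg _) hσ)
    · simp only [beq_iff_eq, hi, if_false, add_zero]
      exact ih.reflect_left (hneg _ i hi)

/-! ### The extremal vector -/

/-- The polynomial whose largest root is `M₁`. -/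
def growthPoly (t : ℝ) : ℝ := t ^ 10 - t ^ 9 - t ^ 8 + t ^ 7 - t ^ 5 + t ^ 3 - t ^ 2 - t + 1

/-- All nonconstant Taylor coefficients at `1.43` are positive. -/
theorem growthPoly_strictMonoOn : StrictMonoOn growthPoly (Set.Ici 1.43) := by
  have taylor : ∀ s : ℝ, growthPoly (1.43 + s) =
      -0.03631797300044207051 + 36.07557555187853653 * s ^ 1 + 206.8555059723558845 * s ^ 2
        + 541.1101745763724 * s ^ 3 + 844.74773317649 * s ^ 4 + 858.1908361036 * s ^ 5
        + 585.2587741 * s ^ 6 + 266.84844 * s ^ 7 + 78.1505 * s ^ 8 + 13.3 * s ^ 9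
        + s ^ 10 := by
    intro s
    unfold growthPoly
    ring
  intro x hx y hy hxy
  obtain ⟨a, rfl⟩ : ∃ a, x = 1.43 + a := ⟨x - 1.43, by ring⟩
  obtain ⟨b, rfl⟩ : ∃ b, y = 1.43 + b := ⟨y - 1.43, by ring⟩
  have ha : 0 ≤ a := by simpa using hx
  have h : ∀ n, n ≠ 0 → a ^ n < b ^ n := fun n hn => pow_lt_pow_left₀ (by linarith) ha hn
  rw [taylor, taylor]
  linarith [h 1 (by decide), h 2 (by decide), h 3 (by decide), h 4 (by decide), h 5 (by decide),
    h 6 (by decide), h 7 (by decide), h 8 (by decide), h 9 (by decide), h 10 (by decide)]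

theorem exists_growthPoly_root : ∃ t : ℝ, 1.430995 ≤ t ∧ t ≤ 1.431005 ∧
    IsGreatest {u : ℝ | growthPoly u = 0} t := by
  have hc : Continuous growthPoly := by unfold growthPoly; fun_prop
  obtain ⟨t, ht, h0⟩ := intermediate_value_Icc (show (1.430995 : ℝ) ≤ 1.431005 by norm_num)
    hc.continuousOn (show (0 : ℝ) ∈ Set.Icc _ _ by
      unfold growthPoly; constructor <;> norm_num)
  refine ⟨t, ht.1, ht.2, h0, fun u hu => ?_⟩
  by_contra! hlt
  have h143 : (1.43 : ℝ) ≤ t := le_trans (by norm_num) ht.1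
  have := growthPoly_strictMonoOn (Set.mem_Ici.2 h143) (Set.mem_Ici.2 (h143.trans hlt.le)) hlt
  rw [h0, show growthPoly u = 0 from hu] at this
  exact lt_irrefl _ this

/-- The multiplicities of the extremal vector. -/
def extremalWeight (t : ℝ) : Fin 10 → ℝ :=
  ![1 + t ^ 3 + t ^ 6, 1 + t ^ 3 + t ^ 7, 1 + t ^ 4 + t ^ 7,
    t * (1 + t ^ 3 + t ^ 6), t * (1 + t ^ 3 + t ^ 7), t * (1 + t ^ 4 + t ^ 7),
    t ^ 2 * (1 + t ^ 3 + t ^ 6), t ^ 2 * (1 + t ^ 3 + t ^ 7), t ^ 2 * (1 + t ^ 4 + t ^ 7),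
    t ^ 3 * (1 + t ^ 3 + t ^ 6)]

/-- The degree of the extremal vector. -/
def extremalDegree (t : ℝ) : ℝ := 2 + 2 * t ^ 3 + t ^ 4 + t ^ 6 + 2 * t ^ 7 + t ^ 10

/-- The extremal vector: it is an eigenvector of `σ⁻¹ s₀` for some `σ ∈ W(A₉)`. -/
def extremalVec (t : ℝ) : Fin 11 → ℝ :=
  Matrix.vecCons (extremalDegree t) fun a => -extremalWeight t a

theorem extremalVec_zero (t : ℝ) : extremalVec t 0 = extremalDegree t := rfl

theorem extremalVec_succ (t : ℝ) (a : Fin 10) : extremalVec t a.succ = -extremalWeight t a := rfl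

theorem lorentz_e_right (x : Fin 11 → ℝ) (i : Fin 11) :
    lorentz x (e i) = if i = 0 then x 0 else -x i := by
  rw [lorentz_comm]
  by_cases h : i = 0 <;> simp [lorentz, gram, e, Matrix.mulVec_diagonal, h]

theorem lorentz_simpleRoot_zero (x : Fin 11 → ℝ) :
    lorentz x (simpleRoot 0) = x 0 + x 1 + x 2 + x 3 := by
  simp only [simpleRoot, if_true, lorentz_sub_right, lorentz_e_right]
  simp

theorem lorentz_simpleRoot_succ (x : Fin 11 → ℝ) (i : Fin 9) :
    lorentz x (simpleRoot i.succ) = x i.succ.succ - x i.castSucc.succ := by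
  have h0 : simpleRoot i.succ = e i.castSucc.succ - e i.succ.succ := by
    simp [simpleRoot, Fin.succ_ne_zero]
  rw [h0, lorentz_sub_right, lorentz_e_right, lorentz_e_right, if_neg (Fin.succ_ne_zero _),
    if_neg (Fin.succ_ne_zero _)]
  ring

theorem extremalVec_antidominant {t : ℝ} (h1 : 1.43 ≤ t) {i : Fin 10}
    (hi : i ≠ 0) : lorentz (extremalVec t) (simpleRoot i) ≤ 0 := by
  obtain ⟨j, rfl⟩ := Fin.exists_succ_eq.2 hi
  rw [lorentz_simpleRoot_succ]
  simp only [extremalVec_succ]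
  have hp : ∀ n, 0 < t ^ n := fun n => pow_pos (by linarith) n
  have e1 : 1 + t ^ 3 + t ^ 6 ≤ 1 + t ^ 3 + t ^ 7 := by nlinarith [hp 6]
  have e2 : 1 + t ^ 3 + t ^ 7 ≤ 1 + t ^ 4 + t ^ 7 := by nlinarith [hp 3]
  have e3 : 1 + t ^ 4 + t ^ 7 ≤ t * (1 + t ^ 3 + t ^ 6) := by linarith
  fin_cases j <;> simp [extremalWeight]
  · linarith
  · linarith
  · linarith
  · exact mul_le_mul_of_nonneg_left e1 (by linarith)
  · exact mul_le_mul_of_nonneg_left e2 (by linarith)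
  · nlinarith
  · nlinarith [hp 2]
  · nlinarith [hp 2]
  · nlinarith [hp 2]

theorem lorentz_extremalVec_zero {t : ℝ} (h : growthPoly t = 0) :
    lorentz (extremalVec t) (simpleRoot 0) = (t - 1) * extremalDegree t := by
  rw [lorentz_simpleRoot_zero]
  have e1 : extremalVec t 1 = -(1 + t ^ 3 + t ^ 6) := rfl
  have e2 : extremalVec t 2 = -(1 + t ^ 3 + t ^ 7) := rfl
  have e3 : extremalVec t 3 = -(1 + t ^ 4 + t ^ 7) := rfl
  rw [extremalVec_zero, e1, e2, e3]
  unfold extremalDegree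
  unfold growthPoly at h
  linear_combination (-(t - 1)) * h

/-- Among the weights `s₀` changes only the first three, so rotation by 3 forces `mₐ₊₃ = t mₐ` as
long as the index does not wrap; hence the shape of `extremalWeight`. The three wrapped conditions
hold modulo `growthPoly t`. -/
theorem reflMatrix_simpleRoot_zero_extremalVec {t : ℝ} (h : growthPoly t = 0) :
    (reflMatrix (simpleRoot 0) *ᵥ extremalVec t) 0 = t * extremalVec t 0 ∧
      ∀ a : Fin 10, (reflMatrix (simpleRoot 0) *ᵥ extremalVec t) (a + 3).succ =
        t * extremalVec t a.succ := by
  have h0 := lorentz_extremalVec_zero h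
  rw [reflMatrix_mulVec, h0]
  unfold growthPoly at h
  constructor
  · rw [Pi.add_apply, Pi.smul_apply, simpleRoot_apply_zero, extremalVec_zero]
    simp
    ring
  · intro a
    rw [Pi.add_apply, Pi.smul_apply, extremalVec_succ, extremalVec_succ]
    fin_cases a <;> simp [simpleRoot, e, extremalWeight, extremalDegree]
    all_goals first | ring1 | linear_combination (-(t - 1)) * h

/-- The vector `3 e₀ - ∑ eᵢ`, which `W` fixes. -/
def canonicalVec : Fin 11 → ℝ := Matrix.vecCons 3 fun _ => -1

theorem rep_canonicalVec (w : W) : rep w *ᵥ canonicalVec = canonicalVec := by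
  induction w using cs.simple_induction with
  | simple i =>
    rw [rep_simple, reflMatrix_mulVec]
    have h : lorentz canonicalVec (simpleRoot i) = 0 := by
      rcases Fin.eq_zero_or_eq_succ i with rfl | ⟨j, rfl⟩
      · rw [lorentz_simpleRoot_zero]
        change (3 : ℝ) + -1 + -1 + -1 = 0
        norm_num
      · rw [lorentz_simpleRoot_succ]
        exact sub_self (-1 : ℝ)
    rw [h, zero_smul, add_zero]
  | one => simp
  | mul v w hv hw => rw [map_mul, ← Matrix.mulVec_mulVec, hw, hv]

/-- This is orthogonality to `canonicalVec`, as expected of an eigenvector with eigenvalue `t ≠ 1`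
against a fixed vector. -/
theorem sum_extremalVec_succ {t : ℝ} (h : growthPoly t = 0) :
    ∑ a : Fin 10, extremalVec t a.succ = -3 * extremalDegree t := by
  simp only [extremalVec_succ, extremalWeight, Fin.sum_univ_succ, extremalDegree]
  unfold growthPoly at h
  simp
  linear_combination 3 * h

/-! ### Permutations and words -/

theorem vec_eq_sum (x : Fin 11 → ℝ) : x = x 0 • e 0 + ∑ a : Fin 10, x a.succ • e a.succ := by
  rw [← Fin.sum_univ_succ (fun i => x i • e i)]
  funext j
  simp [e, Finset.sum_apply, Pi.single_apply]

/-- `rep σ` permutes the coordinates by `π`. -/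
def ActsBy (σ : W) (π : Equiv.Perm (Fin 10)) : Prop :=
  ∀ x : Fin 11 → ℝ, (rep σ *ᵥ x) 0 = x 0 ∧ ∀ a : Fin 10, (rep σ *ᵥ x) (π a).succ = x a.succ

theorem actsBy_of_mem_WA9 {σ : W} (hσ : σ ∈ WA9) {π : Equiv.Perm (Fin 10)}
    (h : ∀ a : Fin 10, rep σ *ᵥ e a.succ = e (π a).succ) : ActsBy σ π := by
  intro x
  have hx : rep σ *ᵥ x = x 0 • e 0 + ∑ a : Fin 10, x a.succ • e (π a).succ := by
    conv_lhs => rw [vec_eq_sum x]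
    rw [Matrix.mulVec_add, Matrix.mulVec_smul, rep_e_zero hσ, Matrix.mulVec_sum]
    congr 1
    exact Finset.sum_congr rfl fun a _ => by rw [Matrix.mulVec_smul, h]
  rw [hx]
  constructor
  · simp [e, Finset.sum_apply]
  · intro b
    simp [e, Finset.sum_apply, Pi.single_apply]

theorem exists_actsBy (π : Equiv.Perm (Fin 10)) : ∃ σ ∈ WA9, ActsBy σ π := by
  obtain ⟨σ, hσ, h⟩ := exists_mem_WA9_perm π
  exact ⟨σ, hσ, actsBy_of_mem_WA9 hσ h⟩

/-- `w` is the product of a word with `n` letters `s₀`. -/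
def HasCount (n : ℕ) (w : W) : Prop := ∃ l : List (Fin 10), cs.wordProd l = w ∧ l.count 0 = n

theorem HasCount.mul {m n : ℕ} {v w : W} (hv : HasCount m v) (hw : HasCount n w) :
    HasCount (m + n) (v * w) := by
  obtain ⟨l, rfl, rfl⟩ := hv
  obtain ⟨k, rfl, rfl⟩ := hw
  exact ⟨l ++ k, cs.wordProd_append l k, List.count_append⟩

theorem HasCount.pow {n : ℕ} {w : W} (hw : HasCount n w) (N : ℕ) :
    HasCount (N * n) (w ^ N) := by
  induction N with
  | zero => exact ⟨[], by simp⟩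
  | succ N ih => rw [pow_succ, Nat.succ_mul]; exact ih.mul hw

theorem hasCount_of_mem_WA9 {σ : W} (hσ : σ ∈ WA9) : HasCount 0 σ := exists_word_of_mem_WA9 hσ

theorem hasCount_kappa (I : Triple) : HasCount 1 (kappa I) := by
  have hσ := (exists_sigma I).choose_spec.1
  have h0 : HasCount 1 (cs.simple 0) := ⟨[0], cs.wordProd_singleton 0, rfl⟩
  exact ((hasCount_of_mem_WA9 hσ).mul h0).mul (hasCount_of_mem_WA9 (inv_mem hσ))

theorem hasCount_s0Length (w : W) : HasCount (s0Length w) w := exists_word_of_s0Length w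

theorem HasCount.s0Length_le {n : ℕ} {w : W} (hw : HasCount n w) : s0Length w ≤ n := by
  obtain ⟨l, rfl, rfl⟩ := hw
  exact s0Length_wordProd_le l

/-! ### Growth of the degree -/

theorem exists_rotation {t : ℝ} (h : growthPoly t = 0) : ∃ σ ∈ WA9,
    reflMatrix (simpleRoot 0) *ᵥ extremalVec t = t • (rep σ *ᵥ extremalVec t) := by
  obtain ⟨σ, hσ, hact⟩ := exists_actsBy (Equiv.addRight 3)
  obtain ⟨h0, h1⟩ := reflMatrix_simpleRoot_zero_extremalVec h
  obtain ⟨a0, a1⟩ := hact (extremalVec t)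
  refine ⟨σ, hσ, ?_⟩
  funext i
  rcases Fin.eq_zero_or_eq_succ i with rfl | ⟨j, rfl⟩
  · rw [h0, Pi.smul_apply, a0, smul_eq_mul]
  · obtain ⟨a, rfl⟩ := (Equiv.addRight (3 : Fin 10)).surjective j
    rw [Pi.smul_apply, a1, smul_eq_mul]
    exact h1 a

theorem extremalDegree_pos {t : ℝ} (ht : 0 ≤ t) : 0 < extremalDegree t := by
  unfold extremalDegree; positivity

theorem HasCount.apply_zero_le {t : ℝ} (h : growthPoly t = 0) (h1 : 1.43 ≤ t) {n : ℕ} {w : W}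
    (hw : HasCount n w) : (rep w *ᵥ extremalVec t) 0 ≤ t ^ n * extremalDegree t := by
  obtain ⟨l, rfl, rfl⟩ := hw
  obtain ⟨σ, hσ, he⟩ := exists_rotation h
  have ht : 0 ≤ t := by linarith
  refine (bruhatLE_wordProd ht (fun i hi => extremalVec_antidominant h1 hi) ?_ hσ he
    l).apply_zero_le
  rw [lorentz_extremalVec_zero h]
  exact mul_nonneg (by linarith) (extremalDegree_pos ht).le

theorem mulVec_e_apply (A : Matrix (Fin 11) (Fin 11) ℝ) (i j : Fin 11) :
    (A *ᵥ e j) i = A i j := by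
  simp [e]

/-- The ten cyclic rotations of the extremal vector, of degree `D`, sum to `D e₀ + 3D k` with `k =
canonicalVec` fixed by `W`. Adding the ten degree bounds gives `D w₀₀ + 9D ≤ 10 tⁿ D`. -/
theorem HasCount.rep_zero_zero_le {t : ℝ} (h : growthPoly t = 0) (h1 : 1.43 ≤ t) {n : ℕ} {w : W}
    (hw : HasCount n w) : rep w 0 0 + 9 ≤ 10 * t ^ n := by
  have ht : 0 ≤ t := by linarith
  choose σ hσ hact using fun c : Fin 10 => exists_actsBy (Equiv.addRight c)
  have hsum : ∑ c, rep (σ c) *ᵥ extremalVec t =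
      extremalDegree t • e 0 + (3 * extremalDegree t) • canonicalVec := by
    funext i
    rw [Finset.sum_apply]
    rcases Fin.eq_zero_or_eq_succ i with rfl | ⟨b, rfl⟩
    · rw [Finset.sum_congr rfl fun c _ => (hact c _).1]
      simp [extremalVec_zero, e, canonicalVec]
      ring
    · have hb : ∀ c, (rep (σ c) *ᵥ extremalVec t) b.succ = extremalVec t (b - c).succ := by
        intro c
        have := (hact c (extremalVec t)).2 (b - c)
        simpa using this
      have hshift : ∑ c, extremalVec t (b - c).succ = ∑ a, extremalVec t (Fin.succ a) :=
        Equiv.sum_comp (Equiv.subLeft b) fun a => extremalVec t a.succ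
      rw [Finset.sum_congr rfl fun c _ => hb c, hshift, sum_extremalVec_succ h]
      simp [e, canonicalVec]
  have hle : ∑ c, (rep w *ᵥ (rep (σ c) *ᵥ extremalVec t)) 0 ≤
      ∑ _c : Fin 10, t ^ n * extremalDegree t := by
    refine Finset.sum_le_sum fun c _ => ?_
    rw [Matrix.mulVec_mulVec, ← map_mul]
    exact (hw.mul (hasCount_of_mem_WA9 (hσ c))).apply_zero_le h h1
  rw [← Finset.sum_apply, ← Matrix.mulVec_sum, hsum, Matrix.mulVec_add, Matrix.mulVec_smul,
    Matrix.mulVec_smul, rep_canonicalVec, Pi.add_apply, Pi.smul_apply, Pi.smul_apply,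
    mulVec_e_apply] at hle
  have hc : canonicalVec 0 = 3 := rfl
  rw [hc] at hle
  simp at hle
  have hD := extremalDegree_pos ht
  refine le_of_mul_le_mul_left ?_ hD
  linarith

/-! ### Bounds for the entries -/

theorem lorentz_self (x : Fin 11 → ℝ) :
    lorentz x x = x 0 ^ 2 - ∑ a : Fin 10, x a.succ ^ 2 := by
  simp only [lorentz, gram, Matrix.mulVec_diagonal, dotProduct]
  rw [Fin.sum_univ_succ, sub_eq_add_neg, ← Finset.sum_neg_distrib]
  congr 1
  · simp [pow_two]
  · exact Finset.sum_congr rfl fun a _ => by simp [Fin.succ_ne_zero, pow_two]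

theorem sq_apply_succ_le (x : Fin 11 → ℝ) (a : Fin 10) :
    x a.succ ^ 2 ≤ x 0 ^ 2 - lorentz x x := by
  have := Finset.single_le_sum (f := fun b : Fin 10 => x b.succ ^ 2)
    (fun b _ => sq_nonneg _) (Finset.mem_univ a)
  rw [lorentz_self]
  linarith

theorem rep_zero_zero_pos (w : W) : 0 < rep w 0 0 := by
  have h : ∀ l : List (Fin 10), 0 < (rep (cs.wordProd l) *ᵥ e 0) 0 := by
    intro l
    induction l with
    | nil => simp [e]
    | cons i l ih =>
      have hn : lorentz (rep (cs.wordProd l) *ᵥ e 0) (rep (cs.wordProd l) *ᵥ e 0) = 1 := by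
        rw [lorentz_rep, lorentz_e]; simp
      rw [rep_wordProd_cons]
      generalize rep (cs.wordProd l) *ᵥ e 0 = y at *
      rw [reflMatrix_mulVec, Pi.add_apply, Pi.smul_apply, simpleRoot_apply_zero]
      split_ifs with hi
      · subst hi
        rw [lorentz_simpleRoot_zero]
        rw [lorentz_self] at hn
        have hs : y 1 ^ 2 + y 2 ^ 2 + y 3 ^ 2 ≤ y 0 ^ 2 := by
          have h3 := Finset.sum_le_univ_sum_of_nonneg (s := ({0, 1, 2} : Finset (Fin 10)))
            (f := fun b : Fin 10 => y b.succ ^ 2) (fun b => sq_nonneg _)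
          rw [Finset.sum_insert (by decide), Finset.sum_insert (by decide),
            Finset.sum_singleton] at h3
          change y 1 ^ 2 + (y 2 ^ 2 + y 3 ^ 2) ≤ _ at h3
          linarith
        simp only [smul_eq_mul, mul_one]
        -- Cauchy–Schwarz gives `(y₁ + y₂ + y₃)² ≤ 3 y₀²`, so the new degree `2y₀ + y₁ + y₂ + y₃`
        -- stays positive.
        have h5 : (y 1 + y 2 + y 3) ^ 2 < (2 * y 0) ^ 2 := by
          nlinarith [sq_nonneg (y 1 - y 2), sq_nonneg (y 1 - y 3), sq_nonneg (y 2 - y 3)]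
        have h6 := abs_lt_of_sq_lt_sq h5 (by linarith)
        linarith [(abs_lt.1 h6).1]
      · simpa using ih
  obtain ⟨l, rfl⟩ := cs.wordProd_surjective w
  exact (h l).trans_eq (mulVec_e_apply _ 0 0)

theorem rep_inv_mulVec (w : W) (x : Fin 11 → ℝ) : rep w⁻¹ *ᵥ (rep w *ᵥ x) = x := by
  rw [Matrix.mulVec_mulVec, ← map_mul, inv_mul_cancel, map_one, Matrix.one_mulVec]

theorem lorentz_rep_left (w : W) (x y : Fin 11 → ℝ) :
    lorentz (rep w *ᵥ x) y = lorentz x (rep w⁻¹ *ᵥ y) := by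
  rw [← lorentz_rep w⁻¹, rep_inv_mulVec]

/-- Row 0 is, up to signs, `w⁻¹ e₀`, of norm 1, so its entries are at most `w₀₀`; each column has
norm `±1`, so its entries are controlled by the one in row 0. -/
theorem abs_rep_le (w : W) (i j : Fin 11) : |rep w i j| ≤ rep w 0 0 + 1 := by
  have hpos := rep_zero_zero_pos w
  have hinv : ∀ k, rep w 0 k ^ 2 = (rep w⁻¹ *ᵥ e 0) k ^ 2 := by
    intro k
    have h := lorentz_rep_left w (e k) (e 0)
    rw [lorentz_e_right, if_pos rfl, mulVec_e_apply, lorentz_comm, lorentz_e_right] at h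
    rw [h]
    split_ifs with hk
    · rw [hk]
    · ring
  have hrow : ∀ k, rep w 0 k ^ 2 ≤ rep w 0 0 ^ 2 := by
    intro k
    rcases Fin.eq_zero_or_eq_succ k with rfl | ⟨a, rfl⟩
    · exact le_rfl
    · have h := sq_apply_succ_le (rep w⁻¹ *ᵥ e 0) a
      rw [← hinv, ← hinv, lorentz_rep, lorentz_e] at h
      simp at h
      linarith
  have hsq : rep w i j ^ 2 ≤ rep w 0 0 ^ 2 + 1 := by
    rcases Fin.eq_zero_or_eq_succ i with rfl | ⟨a, rfl⟩
    · linarith [hrow j]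
    · have h := sq_apply_succ_le (rep w *ᵥ e j) a
      rw [lorentz_rep, lorentz_e, mulVec_e_apply, mulVec_e_apply] at h
      have h2 := hrow j
      split_ifs at h <;> linarith
  refine abs_le_of_sq_le_sq ?_ (by linarith)
  nlinarith

/-! ### Spectral radii -/

theorem exists_eigenvector {A : Matrix (Fin 11) (Fin 11) ℂ} {μ : ℂ} (h : μ ∈ spectrum ℂ A) :
    ∃ z : Fin 11 → ℂ, z ≠ 0 ∧ A *ᵥ z = μ • z := by
  rw [← Matrix.spectrum_toLin'] at h
  obtain ⟨z, hz⟩ := (Module.End.hasEigenvalue_iff_mem_spectrum.2 h).exists_hasEigenvector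
  exact ⟨z, hz.2, by simpa using hz.apply_eq_smul⟩

theorem mem_spectrum_of_mulVec {A : Matrix (Fin 11) (Fin 11) ℂ} {μ : ℂ} {z : Fin 11 → ℂ}
    (hz : z ≠ 0) (h : A *ᵥ z = μ • z) : μ ∈ spectrum ℂ A := by
  rw [← Matrix.spectrum_toLin']
  refine (Module.End.hasEigenvalue_of_hasEigenvector (x := z) ⟨?_, hz⟩).mem_spectrum
  rw [Module.End.mem_eigenspace_iff]
  simpa using h

theorem pow_mulVec_eigenvector {A : Matrix (Fin 11) (Fin 11) ℂ} {μ : ℂ} {z : Fin 11 → ℂ}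
    (h : A *ᵥ z = μ • z) (N : ℕ) : A ^ N *ᵥ z = μ ^ N • z := by
  induction N with
  | zero => simp
  | succ N ih =>
    rw [pow_succ, ← Matrix.mulVec_mulVec, h, Matrix.mulVec_smul, ih, smul_smul, pow_succ']

/-- If the entries of the powers of `A` are `O(rᴺ)`, then all eigenvalues have modulus at
most `r`. -/
theorem norm_le_of_pow_entries_le {A : Matrix (Fin 11) (Fin 11) ℂ} {r C : ℝ} (hr : 0 < r)
    (hA : ∀ N i j, ‖(A ^ N) i j‖ ≤ C * r ^ N) {μ : ℂ} (h : μ ∈ spectrum ℂ A) : ‖μ‖ ≤ r := by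
  obtain ⟨z, hz, hAz⟩ := exists_eigenvector h
  obtain ⟨i, hi⟩ := Function.ne_iff.1 hz
  have hzi : 0 < ‖z i‖ := norm_pos_iff.2 hi
  have hb : ∀ N : ℕ, ‖μ‖ ^ N * ‖z i‖ ≤ (C * ∑ j, ‖z j‖) * r ^ N := by
    intro N
    have h1 := congrFun (pow_mulVec_eigenvector hAz N) i
    calc ‖μ‖ ^ N * ‖z i‖ = ‖(A ^ N *ᵥ z) i‖ := by rw [h1]; simp
      _ ≤ ∑ j, ‖(A ^ N) i j * z j‖ := by
          rw [Matrix.mulVec, dotProduct]; exact norm_sum_le _ _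
      _ ≤ ∑ j, (C * r ^ N) * ‖z j‖ := Finset.sum_le_sum fun j _ => by
          rw [norm_mul]; exact mul_le_mul_of_nonneg_right (hA N i j) (norm_nonneg _)
      _ = _ := by rw [← Finset.mul_sum]; ring
  by_contra! hlt
  obtain ⟨N, hN⟩ := pow_unbounded_of_one_lt ((C * ∑ j, ‖z j‖) / ‖z i‖)
    ((one_lt_div hr).2 hlt)
  rw [div_pow, div_lt_div_iff₀ hzi (pow_pos hr N)] at hN
  exact absurd (hb N) (not_le.2 hN)

theorem HasCount.norm_le {t : ℝ} (h : growthPoly t = 0) (h1 : 1.43 ≤ t) {n : ℕ} {w : W}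
    (hw : HasCount n w) {μ : ℂ} (hμ : μ ∈ spectrum ℂ ((rep w).map (algebraMap ℝ ℂ))) :
    ‖μ‖ ≤ t ^ n := by
  have ht : 0 < t := by linarith
  refine norm_le_of_pow_entries_le (C := 10) (pow_pos ht n) (fun N i j => ?_) hμ
  have hpow : (rep w).map (algebraMap ℝ ℂ) ^ N = (rep (w ^ N)).map (algebraMap ℝ ℂ) := by
    rw [map_pow]
    exact (map_pow (algebraMap ℝ ℂ).mapMatrix (rep w) N).symm
  rw [hpow, Matrix.map_apply, norm_algebraMap', Real.norm_eq_abs]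
  have h2 := (hw.pow N).rep_zero_zero_le h h1
  have h3 := abs_rep_le (w ^ N) i j
  rw [mul_comm N n, pow_mul] at h2
  linarith

theorem HasCount.spectralRadius_le {t : ℝ} (h : growthPoly t = 0) (h1 : 1.43 ≤ t) {n : ℕ} {w : W}
    (hw : HasCount n w) :
    spectralRadius ℂ ((rep w).map (algebraMap ℝ ℂ)) ≤ ENNReal.ofReal (t ^ n) := by
  refine iSup₂_le fun μ hμ => ?_
  rw [← enorm_eq_nnnorm, ← ofReal_norm]
  exact ENNReal.ofReal_le_ofReal (hw.norm_le h h1 hμ)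

theorem HasCount.rho_le {t : ℝ} (h : growthPoly t = 0) (h1 : 1.43 ≤ t) {n : ℕ} {w : W}
    (hw : HasCount n w) : rho w ≤ t ^ n := by
  have ht : 0 ≤ t := by linarith
  exact ENNReal.toReal_le_of_le_ofReal (pow_nonneg ht n) (hw.spectralRadius_le h h1)

theorem le_rho_of_eigenvector {t : ℝ} (h : growthPoly t = 0) (h1 : 1.43 ≤ t) {w : W}
    {x : Fin 11 → ℝ} (hx : x ≠ 0) {r : ℝ} (hr : 0 ≤ r) (hwx : rep w *ᵥ x = r • x) : r ≤ rho w := by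
  have hμ : (r : ℂ) ∈ spectrum ℂ ((rep w).map (algebraMap ℝ ℂ)) := by
    refine mem_spectrum_of_mulVec (z := fun i => (x i : ℂ)) (fun h0 => hx ?_) ?_
    · funext i
      exact Complex.ofReal_eq_zero.1 (congrFun h0 i)
    · funext i
      have := congrFun hwx i
      rw [Matrix.mulVec, dotProduct, Pi.smul_apply, smul_eq_mul] at this
      rw [Matrix.mulVec, dotProduct, Pi.smul_apply, smul_eq_mul]
      simp only [Matrix.map_apply, Complex.coe_algebraMap]
      exact_mod_cast this
  have hle : ENNReal.ofReal r ≤ spectralRadius ℂ ((rep w).map (algebraMap ℝ ℂ)) := by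
    refine le_trans ?_ (le_iSup₂ (f := fun (k : ℂ) (_ : k ∈ spectrum ℂ
      ((rep w).map (algebraMap ℝ ℂ))) => (‖k‖₊ : ENNReal)) _ hμ)
    rw [ENNReal.ofReal]
    refine ENNReal.coe_le_coe.2 ?_
    rw [← NNReal.coe_le_coe, Real.coe_toNNReal r hr]
    simp [abs_of_nonneg hr]
  rw [rho, ← ENNReal.toReal_ofReal hr]
  -- Finiteness matters because `toReal` sends `⊤` to `0`; it comes from the upper bound.
  refine ENNReal.toReal_mono (ne_top_of_le_ne_top ENNReal.ofReal_ne_top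
    ((hasCount_s0Length w).spectralRadius_le h h1)) hle

/-! ### Products of `κ`s that attain the maximum -/

theorem exists_perm_of_mem_WA9 {σ : W} (hσ : σ ∈ WA9) : ∃ π : Equiv.Perm (Fin 10),
    ∀ a : Fin 10, rep σ *ᵥ e a.succ = e (π a).succ := by
  induction hσ using Subgroup.closure_induction with
  | mem x hx =>
    obtain ⟨i, hi, rfl⟩ := hx
    obtain ⟨j, rfl⟩ := Fin.exists_succ_eq.2 hi
    exact ⟨Equiv.swap j.castSucc j.succ, fun a => by rw [rep_simple, reflMatrix_simple_e]⟩
  | one => exact ⟨1, fun a => by simp⟩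
  | mul x y _ _ hx hy =>
    obtain ⟨π, h1⟩ := hx
    obtain ⟨τ, h2⟩ := hy
    exact ⟨π * τ, fun a => by
      rw [map_mul, ← Matrix.mulVec_mulVec, h2, h1, Equiv.Perm.mul_apply]⟩
  | inv x _ hx =>
    obtain ⟨π, h⟩ := hx
    refine ⟨π⁻¹, fun a => ?_⟩
    have h1 := h (π⁻¹ a)
    rw [← Equiv.Perm.mul_apply, mul_inv_cancel, Equiv.Perm.one_apply] at h1
    rw [← h1, rep_inv_mulVec]

theorem rep_conj_reflMatrix (w : W) (α : Fin 11 → ℝ) :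
    rep w * reflMatrix α * rep w⁻¹ = reflMatrix (rep w *ᵥ α) := by
  refine Matrix.ext_of_mulVec_single fun i => ?_
  have hinv : ∀ v, rep w *ᵥ (rep w⁻¹ *ᵥ v) = v := fun v => by
    rw [Matrix.mulVec_mulVec, ← map_mul, mul_inv_cancel, map_one, Matrix.one_mulVec]
  rw [← Matrix.mulVec_mulVec, ← Matrix.mulVec_mulVec, reflMatrix_mulVec, reflMatrix_mulVec,
    Matrix.mulVec_add, Matrix.mulVec_smul, hinv, ← lorentz_rep w, hinv]

theorem simpleRoot_zero_eq :
    simpleRoot 0 = e 0 - ∑ a ∈ ({0, 1, 2} : Finset (Fin 10)), e a.succ := by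
  rw [Finset.sum_insert (by decide), Finset.sum_insert (by decide), Finset.sum_singleton]
  simp only [simpleRoot, if_true]
  rw [show (0 : Fin 10).succ = 1 from rfl, show (1 : Fin 10).succ = 2 from rfl,
    show (2 : Fin 10).succ = 3 from rfl]
  abel

theorem exists_rep_kappa_eq {σ : W} (hσ : σ ∈ WA9) :
    ∃ I : Triple, rep (kappa I) = rep (σ * cs.simple 0 * σ⁻¹) := by
  obtain ⟨π, hπ⟩ := exists_perm_of_mem_WA9 hσ
  refine ⟨⟨({0, 1, 2} : Finset (Fin 10)).map π.toEmbedding, by rw [Finset.card_map]; rfl⟩, ?_⟩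
  rw [rep_kappa, map_mul, map_mul, rep_simple, rep_conj_reflMatrix, simpleRoot_zero_eq,
    Matrix.mulVec_sub, rep_e_zero hσ, Matrix.mulVec_sum, tripleRoot, Finset.sum_map]
  congr 2
  exact Finset.sum_congr rfl fun a _ => (hπ a).symm

theorem kappaProd_snoc {n : ℕ} (I : Fin n → Triple) (J : Triple) :
    kappaProd (Fin.snoc I J : Fin (n + 1) → Triple) = kappaProd I * kappa J := by
  rw [kappaProd, List.ofFn_succ', List.prod_concat]
  simp [kappaProd]

theorem hasCount_kappaProd {n : ℕ} (I : Fin n → Triple) : HasCount n (kappaProd I) := by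
  induction n with
  | zero => exact ⟨[], by simp [kappaProd]⟩
  | succ n ih =>
    rw [← Fin.snoc_init_self I, kappaProd_snoc]
    exact (ih _).mul (hasCount_kappa _)

/-- Moving every `σ` to the right conjugates the `k`-th `s₀` by `σᵏ` and leaves `τ = σⁿ`. The
equality is stated after `rep`, since `kappa` uses its own choice of conjugating element. -/
theorem exists_kappaProd_rep_eq {σ : W} (hσ : σ ∈ WA9) (n : ℕ) :
    ∃ I : Fin n → Triple, ∃ τ ∈ WA9,
      rep (kappaProd I * τ) = rep ((σ * cs.simple 0) ^ n) := by
  induction n with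
  | zero => exact ⟨Fin.elim0, 1, one_mem _, by simp [kappaProd]⟩
  | succ n ih =>
    obtain ⟨I, τ, hτ, h⟩ := ih
    have hm := mul_mem hτ hσ
    obtain ⟨J, hJ⟩ := exists_rep_kappa_eq hm
    refine ⟨Fin.snoc I J, τ * σ, hm, ?_⟩
    rw [kappaProd_snoc, pow_succ, map_mul, map_mul, hJ, map_mul rep ((σ * cs.simple 0) ^ n), ← h,
      ← map_mul, ← map_mul, ← map_mul]
    congr 1
    group

theorem exists_tuple_eigenvector {t : ℝ} (h : growthPoly t = 0) (n : ℕ) :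
    ∃ I : Fin n → Triple, ∃ τ ∈ WA9,
      rep (kappaProd I * τ) *ᵥ extremalVec t = t ^ n • extremalVec t := by
  obtain ⟨σ, hσ, he⟩ := exists_rotation h
  obtain ⟨I, τ, hτ, hI⟩ := exists_kappaProd_rep_eq (inv_mem hσ) n
  refine ⟨I, τ, hτ, ?_⟩
  have h1 : rep (σ⁻¹ * cs.simple 0) *ᵥ extremalVec t = t • extremalVec t := by
    rw [map_mul, ← Matrix.mulVec_mulVec, rep_simple, he, Matrix.mulVec_smul, rep_inv_mulVec]
  have h2 : ∀ m : ℕ, rep ((σ⁻¹ * cs.simple 0) ^ m) *ᵥ extremalVec t = t ^ m • extremalVec t := by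
    intro m
    induction m with
    | zero => simp
    | succ m ih =>
      rw [pow_succ, map_mul, ← Matrix.mulVec_mulVec, h1, Matrix.mulVec_smul, ih, smul_smul,
        pow_succ']
  rw [hI, h2]

theorem extremalVec_ne_zero {t : ℝ} (ht : 0 ≤ t) : extremalVec t ≠ 0 := fun h =>
  (extremalDegree_pos ht).ne' (congrFun h 0)

theorem rho_eq_of_eigenvector {t : ℝ} (h : growthPoly t = 0) (h1 : 1.43 ≤ t) {n : ℕ} {w : W}
    (hw : HasCount n w) (hwx : rep w *ᵥ extremalVec t = t ^ n • extremalVec t) :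
    rho w = t ^ n := by
  have ht : 0 ≤ t := by linarith
  exact le_antisymm (hw.rho_le h h1)
    (le_rho_of_eigenvector h h1 (extremalVec_ne_zero ht) (pow_nonneg ht n) hwx)

/-- An element with eigenvalue `tⁿ` has `s₀`-length at least `n`. -/
theorem le_of_hasCount {t : ℝ} (h : growthPoly t = 0) (h1 : 1.43 ≤ t) {m n : ℕ} {w : W}
    (hw : HasCount m w) {x : Fin 11 → ℝ} (hx : x ≠ 0) (hwx : rep w *ᵥ x = t ^ n • x) : n ≤ m := by
  have ht : 0 ≤ t := by linarith
  have hle := (le_rho_of_eigenvector h h1 hx (pow_nonneg ht n) hwx).trans (hw.rho_le h h1)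
  exact (pow_le_pow_iff_right₀ (by linarith)).1 hle

theorem s0Level_eq_of_eigenvector {t : ℝ} (h : growthPoly t = 0) (h1 : 1.43 ≤ t) {n : ℕ} {w : W}
    (hw : HasCount n w) (hwx : rep w *ᵥ extremalVec t = t ^ n • extremalVec t) :
    s0Level w = n := by
  have ht : 0 ≤ t := by linarith
  have hmem : s0Length w ∈ {m | ∃ v : W, IsConj w v ∧ s0Length v = m} := ⟨w, IsConj.refl w, rfl⟩
  refine le_antisymm ((Nat.sInf_le hmem).trans hw.s0Length_le) ?_
  obtain ⟨v, hv, hlen⟩ := Nat.sInf_mem ⟨_, hmem⟩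
  obtain ⟨g, rfl⟩ := isConj_iff.1 hv
  have hcount := hasCount_s0Length (g * w * g⁻¹)
  rw [hlen] at hcount
  -- The conjugate by `g` has `g v` as eigenvector with the same eigenvalue.
  refine le_of_hasCount h h1 hcount (x := rep g *ᵥ extremalVec t) (fun h0 => ?_) ?_
  · refine extremalVec_ne_zero ht ?_
    rw [← rep_inv_mulVec g (extremalVec t), h0, Matrix.mulVec_zero]
  · rw [map_mul, map_mul, ← Matrix.mulVec_mulVec, ← Matrix.mulVec_mulVec, rep_inv_mulVec, hwx,
      Matrix.mulVec_smul]

theorem rho_le_of_mem_D {t : ℝ} (h : growthPoly t = 0) (h1 : 1.43 ≤ t) {n : ℕ} {w : W}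
    (hw : w ∈ D n) : rho w ≤ t ^ n := by
  obtain ⟨I, -, hI⟩ := Set.mem_iUnion₂.1 hw
  obtain ⟨a, ha, b, hb, rfl⟩ := DoubleCoset.mem_doubleCoset.1 hI
  have hc := ((hasCount_of_mem_WA9 ha).mul (hasCount_kappaProd I)).mul (hasCount_of_mem_WA9 hb)
  rw [zero_add, add_zero] at hc
  exact hc.rho_le h h1

theorem exists_mem_Dlevel {t : ℝ} (h : growthPoly t = 0) (h1 : 1.43 ≤ t) (n : ℕ) :
    ∃ w ∈ Dlevel n, rho w = t ^ n := by
  have ht : 0 ≤ t := by linarith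
  obtain ⟨I, τ, hτ, hI⟩ := exists_tuple_eigenvector h n
  have hc : HasCount n (kappaProd I * τ) := (hasCount_kappaProd I).mul (hasCount_of_mem_WA9 hτ)
  -- The factor `τ` contributes no `s₀`, so the eigenvalue `tⁿ` also bounds the `s₀`-length of the
  -- `κ`-product from below.
  have htup : I ∈ tuples n :=
    le_antisymm (hasCount_kappaProd I).s0Length_le (le_of_hasCount h h1
      ((hasCount_s0Length _).mul (hasCount_of_mem_WA9 hτ)) (extremalVec_ne_zero ht) hI)
  exact ⟨_, ⟨Set.mem_iUnion₂.2 ⟨I, htup, DoubleCoset.mem_doubleCoset.2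
    ⟨1, one_mem WA9, τ, hτ, by rw [one_mul]⟩⟩, s0Level_eq_of_eigenvector h h1 hc hI⟩,
    rho_eq_of_eigenvector h h1 hc hI⟩

theorem isGreatest_Lam {t : ℝ} (h : growthPoly t = 0) (h1 : 1.43 ≤ t) (n : ℕ) :
    IsGreatest (Lam n) (t ^ n) := by
  refine ⟨exists_mem_Dlevel h h1 n, ?_⟩
  rintro _ ⟨w, hw, rfl⟩
  exact rho_le_of_mem_D h h1 hw.1

theorem isGreatest_LamTilde {t : ℝ} (h : growthPoly t = 0) (h1 : 1.43 ≤ t) (n : ℕ) :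
    IsGreatest (LamTilde n) (t ^ n) := by
  obtain ⟨w, hw, hr⟩ := exists_mem_Dlevel h h1 n
  refine ⟨⟨w, hw.1, hr⟩, ?_⟩
  rintro _ ⟨w, hw, rfl⟩
  exact rho_le_of_mem_D h h1 hw

theorem M_eq {t : ℝ} (h : growthPoly t = 0) (h1 : 1.43 ≤ t) (n : ℕ) : M n = t ^ n :=
  (isGreatest_LamTilde h h1 n).csSup_eq

end E10

end

theorem mainTheorem6 :
    (∀ k : ℕ, 1 ≤ k →
      IsGreatest (E10.LamTilde k) (E10.M k) ∧
      IsGreatest (E10.Lam k) (E10.M k) ∧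
      E10.M k = E10.M 1 ^ k) ∧
    IsGreatest {t : ℝ | t ^ 10 - t ^ 9 - t ^ 8 + t ^ 7 - t ^ 5 + t ^ 3 - t ^ 2 - t + 1 = 0}
      (E10.M 1) ∧
    |E10.M 1 - 1.43100| ≤ 0.000005 := by
  obtain ⟨t, ht1, ht2, hgr⟩ := E10.exists_growthPoly_root
  have h : E10.growthPoly t = 0 := hgr.1
  have h1 : 1.43 ≤ t := le_trans (by norm_num) ht1
  have hM : E10.M 1 = t := by rw [E10.M_eq h h1, pow_one]
  refine ⟨fun k _ => ?_, ?_, ?_⟩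
  · rw [hM, E10.M_eq h h1]
    exact ⟨E10.isGreatest_LamTilde h h1 k, E10.isGreatest_Lam h h1 k, rfl⟩
  · rw [hM]
    exact hgr
  · rw [hM, abs_le]
    constructor <;> norm_num <;> linarith
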